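/- Let $N\ge 1$ be an integer, let $0<s<1$, and let $b:\mathbb{R}^N\to\mathbb{R}$ be continuous with $\inf_{x\in\mathbb{R}^N} b(x)>0$ and such that, for every $M>0$, the set $\{x\in\mathbb{R}^N : b(x)\le M\}$ has finite Lebesgue measure. Write $\mathbb{R}^{N+1}_+=\mathbb{R}^N\times(0,\infty)$ with points $(x,t)$, and let $H(\mathbb{R}^{N+1}_+)$ be the space of all real-valued $u\in L^2(\mathbb{R}^{N+1}_+)$ that have a weak gradient $\nabla u=(\nabla_x u,\partial_t u)$ on $\mathbb{R}^{N+1}_+$ and satisfy $$\|u\|^2:=\iint_{\mathbb{R}^{N+1}_+}\left[|\nabla u(x,t)|^2+b(x)\,|u(x,t)|^2\right]t^{1-2s}\,dx\,dt<\infty ,$$ equipped with this energy norm (it is the extension space for $(-\Delta+b(x))^s$). Then every $u\in H(\mathbb{R}^{N+1}_+)$ has a unique trace $Tu\in L^2(\mathbb{R}^N)$ on $\mathbb{R}^N\times\{0\}$, that is, $\|u(\cdot,t)-Tu\|_{L^2(\mathbb{R}^N)}\to 0$ as $t\downarrow 0$ (the limit being taken along almost every $t$), and the trace map $T:H(\mathbb{R}^{N+1}_+)\to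 L^2(\mathbb{R}^N)$ is linear, continuous and compact. In other words, the embedding $H(\mathbb{R}^{N+1}_+)\subset L^2(\mathbb{R}^N)$ is compact in the trace sense. -/

import Mathlib

open MeasureTheory Filter Topology Set
open scoped ENNReal ContDiff

noncomputable section

namespace ExtensionSpace

/-- The open half space `ℝ^N × (0, ∞)`, with points written `(x, t)`. -/
def halfSpace (N : ℕ) : Set (EuclideanSpace ℝ (Fin N) × ℝ) := univ ×ˢ Ioi 0

/-- Lebesgue measure `dx dt` on the half space. -/
def halfVolume (N : ℕ) : Measure (EuclideanSpace ℝ (Fin N) × ℝ) :=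
  volume.restrict (halfSpace N)

/-- The measure `t^{1-2s} dx dt` on the half space. -/
def weightedVolume (N : ℕ) (s : ℝ) : Measure (EuclideanSpace ℝ (Fin N) × ℝ) :=
  (halfVolume N).withDensity (fun p => ENNReal.ofReal (p.2 ^ (1 - 2 * s)))

/-- The measure `b(x) t^{1-2s} dx dt` on the half space. -/
def potentialVolume {N : ℕ} (b : EuclideanSpace ℝ (Fin N) → ℝ) (s : ℝ) :
    Measure (EuclideanSpace ℝ (Fin N) × ℝ) :=
  (weightedVolume N s).withDensity (fun p => ENNReal.ofReal (b p.1))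

/-- Values of a full gradient `(∇ₓ u, ∂ₜ u)`, with `‖(a, τ)‖² = |a|² + τ²`. -/
abbrev GradVal (N : ℕ) : Type := WithLp 2 (EuclideanSpace ℝ (Fin N) × ℝ)

/-- `G` is the weak (distributional) gradient of `u` on the open half space:
`∬ u ∂ᵥφ = - ∬ φ ⟨v, G⟩` for all `φ ∈ C_c^∞(ℝ^N × (0, ∞))` and all directions `v`. -/
def IsWeakGradient {N : ℕ} (u : EuclideanSpace ℝ (Fin N) × ℝ → ℝ)
    (G : EuclideanSpace ℝ (Fin N) × ℝ → GradVal N) : Prop :=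
  LocallyIntegrableOn G (halfSpace N) ∧
  ∀ φ : EuclideanSpace ℝ (Fin N) × ℝ → ℝ, ContDiff ℝ ∞ φ → HasCompactSupport φ →
    tsupport φ ⊆ halfSpace N → ∀ v : EuclideanSpace ℝ (Fin N) × ℝ,
      ∫ p in halfSpace N, u p * fderiv ℝ φ p v =
        - ∫ p in halfSpace N, φ p * inner ℝ (WithLp.toLp 2 v) (G p)

variable {N : ℕ}

lemma isOpen_halfSpace (N : ℕ) : IsOpen (halfSpace N) := isOpen_univ.prod isOpen_Ioi

lemma weightedVolume_ac (s : ℝ) : weightedVolume N s ≪ halfVolume N :=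
  withDensity_absolutelyContinuous _ _

lemma potentialVolume_ac (b : EuclideanSpace ℝ (Fin N) → ℝ) (s : ℝ) :
    potentialVolume b s ≪ halfVolume N :=
  (withDensity_absolutelyContinuous _ _).trans (weightedVolume_ac s)

lemma integrable_test_mul_inner {G : EuclideanSpace ℝ (Fin N) × ℝ → GradVal N}
    (hG : LocallyIntegrableOn G (halfSpace N)) {φ : EuclideanSpace ℝ (Fin N) × ℝ → ℝ}
    (hφ : ContDiff ℝ ∞ φ) (hc : HasCompactSupport φ) (hs : tsupport φ ⊆ halfSpace N) :
    Integrable (fun p => φ p • G p) := by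
  have h1 : IntegrableOn G (tsupport φ) := hG.integrableOn_compact_subset hs hc
  have h2 : IntegrableOn (fun p => φ p • G p) (tsupport φ) :=
    h1.continuousOn_smul hφ.continuous.continuousOn hc
  rw [integrableOn_iff_integrable_of_support_subset] at h2
  · exact h2
  · intro p hp
    apply subset_tsupport φ
    intro h
    exact hp (by simp [h])

lemma integrable_mul_fderiv {u : EuclideanSpace ℝ (Fin N) × ℝ → ℝ} (hu : MemLp u 2 (halfVolume N))
    {φ : EuclideanSpace ℝ (Fin N) × ℝ → ℝ}
    (hφ : ContDiff ℝ ∞ φ) (hc : HasCompactSupport φ) (v : EuclideanSpace ℝ (Fin N) × ℝ) :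
    Integrable (fun p => u p * fderiv ℝ φ p v) (halfVolume N) := by
  have h1 : Continuous (fun p => fderiv ℝ φ p v) :=
    (hφ.continuous_fderiv (by simp)).clm_apply continuous_const
  have h2 : HasCompactSupport (fun p => fderiv ℝ φ p v) := hc.fderiv_apply (𝕜 := ℝ) v
  have h3 : MemLp (fun p => fderiv ℝ φ p v) 2 (halfVolume N) :=
    (h1.memLp_of_hasCompactSupport h2 (p := 2) (μ := volume)).restrict _
  exact hu.integrable_mul h3

lemma IsWeakGradient.integrable {u : EuclideanSpace ℝ (Fin N) × ℝ → ℝ}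
    {G : EuclideanSpace ℝ (Fin N) × ℝ → GradVal N} (h : IsWeakGradient u G)
    {φ : EuclideanSpace ℝ (Fin N) × ℝ → ℝ}
    (hφ : ContDiff ℝ ∞ φ) (hc : HasCompactSupport φ) (hs : tsupport φ ⊆ halfSpace N)
    (v : GradVal N) :
    Integrable (fun p => φ p * inner ℝ v (G p)) (halfVolume N) := by
  have := ((integrable_test_mul_inner h.1 hφ hc hs).const_inner (𝕜 := ℝ) v).restrict
    (s := halfSpace N)
  simpa [inner_smul_right, halfVolume] using this

lemma IsWeakGradient.congr {u u' : EuclideanSpace ℝ (Fin N) × ℝ → ℝ}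
    {G : EuclideanSpace ℝ (Fin N) × ℝ → GradVal N} (h : IsWeakGradient u G)
    (hu : u =ᵐ[halfVolume N] u') : IsWeakGradient u' G := by
  refine ⟨h.1, fun φ hφ hc hs v => ?_⟩
  rw [← h.2 φ hφ hc hs v]
  refine integral_congr_ae ?_
  filter_upwards [hu] with p hp
  rw [hp]

lemma IsWeakGradient.add {u u' : EuclideanSpace ℝ (Fin N) × ℝ → ℝ}
    {G G' : EuclideanSpace ℝ (Fin N) × ℝ → GradVal N}
    (hu : MemLp u 2 (halfVolume N)) (hu' : MemLp u' 2 (halfVolume N))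
    (h : IsWeakGradient u G) (h' : IsWeakGradient u' G') :
    IsWeakGradient (u + u') (G + G') := by
  refine ⟨h.1.add h'.1, fun φ hφ hc hs v => ?_⟩
  simp only [Pi.add_apply, add_mul, inner_add_right, mul_add]
  have e1 := integral_add (integrable_mul_fderiv hu hφ hc v) (integrable_mul_fderiv hu' hφ hc v)
  have e2 := integral_add (h.integrable hφ hc hs (WithLp.toLp 2 v))
    (h'.integrable hφ hc hs (WithLp.toLp 2 v))
  unfold halfVolume at e1 e2
  rw [e1, e2, h.2 φ hφ hc hs v, h'.2 φ hφ hc hs v, neg_add]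

lemma IsWeakGradient.const_smul {u : EuclideanSpace ℝ (Fin N) × ℝ → ℝ}
    {G : EuclideanSpace ℝ (Fin N) × ℝ → GradVal N} (h : IsWeakGradient u G) (c : ℝ) :
    IsWeakGradient (c • u) (c • G) := by
  refine ⟨h.1.smul c, fun φ hφ hc hs v => ?_⟩
  simp only [Pi.smul_apply, smul_eq_mul, inner_smul_right, mul_assoc, mul_left_comm _ c]
  rw [integral_const_mul, integral_const_mul, h.2 φ hφ hc hs v, mul_neg]

lemma isWeakGradient_zero : IsWeakGradient (0 : EuclideanSpace ℝ (Fin N) × ℝ → ℝ) 0 := by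
  refine ⟨(locallyIntegrable_zero).locallyIntegrableOn _, fun φ _ _ _ v => ?_⟩
  simp

/-- Weak gradients are unique almost everywhere. -/
lemma IsWeakGradient.unique {u : EuclideanSpace ℝ (Fin N) × ℝ → ℝ}
    {G G' : EuclideanSpace ℝ (Fin N) × ℝ → GradVal N}
    (h : IsWeakGradient u G) (h' : IsWeakGradient u G') : G =ᵐ[halfVolume N] G' := by
  have key := (isOpen_halfSpace N).ae_eq_zero_of_integral_contDiff_smul_eq_zero
    (μ := volume) (h.1.sub h'.1) (fun φ hφ hc hs => by
      have i1 := integrable_test_mul_inner h.1 hφ hc hs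
      have i2 := integrable_test_mul_inner h'.1 hφ hc hs
      have i3 : Integrable (fun p => φ p • (G - G') p) := by
        refine (i1.sub i2).congr (Eventually.of_forall fun p => ?_)
        simp [smul_sub]
      refine ext_inner_left ℝ fun v => ?_
      rw [inner_zero_right, ← integral_inner i3]
      have hsupp : Function.support (fun p => inner ℝ v (φ p • (G - G') p)) ⊆ halfSpace N := by
        intro p hp
        apply hs
        apply subset_tsupport φ
        intro h0
        exact hp (by simp [h0])
      rw [← setIntegral_eq_integral_of_forall_compl_eq_zero
        (s := halfSpace N) (fun p hp => by
          by_contra hne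
          exact hp (hsupp hne))]
      have e1 := h.2 φ hφ hc hs v.ofLp
      have e2 := h'.2 φ hφ hc hs v.ofLp
      have e3 := integral_sub (h.integrable hφ hc hs v) (h'.integrable hφ hc hs v)
      unfold halfVolume at e3
      simp only [Pi.sub_apply, inner_smul_right, inner_sub_right, mul_sub]
      rw [e3]
      simp only [WithLp.toLp_ofLp] at e1 e2
      linarith)
  unfold halfVolume
  rw [EventuallyEq, ae_restrict_iff' (isOpen_halfSpace N).measurableSet]
  filter_upwards [key] with p hp hmem
  exact sub_eq_zero.1 (hp hmem)

/-- The functions `u ∈ L²(ℝ^{N+1}_+)` with a weak gradient `∇u` such that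
`∬ (|∇u|² + b(x) u²) t^{1-2s} dx dt < ∞`. -/
def finiteEnergy (b : EuclideanSpace ℝ (Fin N) → ℝ) (s : ℝ) :
    Submodule ℝ (Lp ℝ 2 (halfVolume N)) where
  carrier := {u | MemLp u 2 (potentialVolume b s) ∧
    ∃ G, IsWeakGradient u G ∧ MemLp G 2 (weightedVolume N s)}
  zero_mem' := by
    have h0 := Lp.coeFn_zero ℝ 2 (halfVolume N)
    refine ⟨?_, 0, isWeakGradient_zero.congr h0.symm, MemLp.zero⟩
    exact (memLp_congr_ae ((potentialVolume_ac b s).ae_le h0)).2 MemLp.zero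
  add_mem' := by
    rintro u v ⟨hu, G, hG, hG2⟩ ⟨hv, F, hF, hF2⟩
    have h0 := Lp.coeFn_add u v
    refine ⟨?_, G + F, (hG.add (Lp.memLp u) (Lp.memLp v) hF).congr h0.symm, hG2.add hF2⟩
    exact (memLp_congr_ae ((potentialVolume_ac b s).ae_le h0)).2 (hu.add hv)
  smul_mem' := by
    rintro c u ⟨hu, G, hG, hG2⟩
    have h0 := Lp.coeFn_smul c u
    refine ⟨?_, c • G, (hG.const_smul c).congr h0.symm, hG2.const_smul c⟩
    exact (memLp_congr_ae ((potentialVolume_ac b s).ae_le h0)).2 (hu.const_smul c)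

/-- The extension space `H(ℝ^{N+1}_+)` of `(-Δ + b(x))^s`. It is a copy of `finiteEnergy b s`
that does not carry the topology of `L²(ℝ^{N+1}_+)`, but the energy norm defined below. -/
def H (b : EuclideanSpace ℝ (Fin N) → ℝ) (s : ℝ) : Type := finiteEnergy b s

instance (b : EuclideanSpace ℝ (Fin N) → ℝ) (s : ℝ) : AddCommGroup (H b s) :=
  inferInstanceAs (AddCommGroup (finiteEnergy b s))

instance (b : EuclideanSpace ℝ (Fin N) → ℝ) (s : ℝ) : Module ℝ (H b s) :=
  inferInstanceAs (Module ℝ (finiteEnergy b s))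

variable {b : EuclideanSpace ℝ (Fin N) → ℝ} {s : ℝ}

/-- The underlying (almost everywhere defined) function on the half space. -/
def H.toFun (u : H b s) : EuclideanSpace ℝ (Fin N) × ℝ → ℝ := (Subtype.val u : Lp ℝ 2 (halfVolume N))

/-- The weak gradient `∇u` (unique almost everywhere). -/
def H.grad (u : H b s) : EuclideanSpace ℝ (Fin N) × ℝ → GradVal N :=
  (Subtype.prop u).2.choose

lemma H.memLp_toFun (u : H b s) : MemLp u.toFun 2 (potentialVolume b s) := (Subtype.prop u).1

lemma H.isWeakGradient_grad (u : H b s) : IsWeakGradient u.toFun u.grad :=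
  (Subtype.prop u).2.choose_spec.1

lemma H.memLp_grad (u : H b s) : MemLp u.grad 2 (weightedVolume N s) :=
  (Subtype.prop u).2.choose_spec.2

lemma H.toFun_add (u v : H b s) : (u + v).toFun =ᵐ[halfVolume N] u.toFun + v.toFun :=
  Lp.coeFn_add (Subtype.val u) (Subtype.val v)

lemma H.toFun_smul (c : ℝ) (u : H b s) : (c • u).toFun =ᵐ[halfVolume N] c • u.toFun :=
  Lp.coeFn_smul c (Subtype.val u)

lemma H.grad_add (u v : H b s) : (u + v).grad =ᵐ[halfVolume N] u.grad + v.grad :=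
  (u + v).isWeakGradient_grad.unique <|
    (u.isWeakGradient_grad.add (Lp.memLp (Subtype.val u)) (Lp.memLp (Subtype.val v))
      v.isWeakGradient_grad).congr (H.toFun_add u v).symm

lemma H.grad_smul (c : ℝ) (u : H b s) : (c • u).grad =ᵐ[halfVolume N] c • u.grad :=
  (c • u).isWeakGradient_grad.unique <|
    (u.isWeakGradient_grad.const_smul c).congr (H.toFun_smul c u).symm

/-- The linear map `u ↦ (u, ∇u)` into `L²(b t^{1-2s} dx dt) × L²(t^{1-2s} dx dt)`. -/
def H.energyMap (b : EuclideanSpace ℝ (Fin N) → ℝ) (s : ℝ) : H b s →ₗ[ℝ]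
    WithLp 2 (Lp ℝ 2 (potentialVolume b s) × Lp (GradVal N) 2 (weightedVolume N s)) where
  toFun u := WithLp.toLp 2 (u.memLp_toFun.toLp u.toFun, u.memLp_grad.toLp u.grad)
  map_add' u v := by
    rw [← WithLp.toLp_add, Prod.mk_add_mk, ← MemLp.toLp_add, ← MemLp.toLp_add,
      MemLp.toLp_eq_toLp_iff _ _ |>.2 ((potentialVolume_ac b s).ae_le (H.toFun_add u v)),
      MemLp.toLp_eq_toLp_iff _ _ |>.2 ((weightedVolume_ac s).ae_le (H.grad_add u v))]
  map_smul' c u := by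
    rw [RingHom.id_apply, ← WithLp.toLp_smul, Prod.smul_mk, ← MemLp.toLp_const_smul,
      ← MemLp.toLp_const_smul,
      MemLp.toLp_eq_toLp_iff _ _ |>.2 ((potentialVolume_ac b s).ae_le (H.toFun_smul c u)),
      MemLp.toLp_eq_toLp_iff _ _ |>.2 ((weightedVolume_ac s).ae_le (H.grad_smul c u))]

/-- The energy norm `‖u‖² = ∬ (|∇u|² + b(x) u²) t^{1-2s} dx dt` (see `H.norm_sq_eq` below). It is
declared as a seminorm only because no hypothesis on `b` is needed for that. -/
instance (b : EuclideanSpace ℝ (Fin N) → ℝ) (s : ℝ) : SeminormedAddCommGroup (H b s) :=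
  SeminormedAddCommGroup.induced (H b s) _ (H.energyMap b s)

instance (b : EuclideanSpace ℝ (Fin N) → ℝ) (s : ℝ) : NormedSpace ℝ (H b s) :=
  NormedSpace.induced ℝ (H b s) _ (H.energyMap b s)

lemma integral_weightedVolume (s : ℝ) (f : EuclideanSpace ℝ (Fin N) × ℝ → ℝ) :
    ∫ p, f p ∂(weightedVolume N s) = ∫ p in halfSpace N, f p * p.2 ^ (1 - 2 * s) := by
  unfold weightedVolume
  rw [integral_withDensity_eq_integral_toReal_smul (by fun_prop) (by simp)]
  refine setIntegral_congr_fun (isOpen_halfSpace N).measurableSet fun p hp => ?_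
  have : 0 < p.2 := hp.2
  simp only [smul_eq_mul]
  rw [ENNReal.toReal_ofReal (by positivity), mul_comm]

lemma H.norm_sq_eq (hb : Continuous b) (hb0 : ∀ x, 0 ≤ b x) (u : H b s) :
    ‖u‖ ^ 2 = ∫ p in halfSpace N,
      (‖u.grad p‖ ^ 2 + b p.1 * u.toFun p ^ 2) * p.2 ^ (1 - 2 * s) := by
  have hm : Measurable fun p : EuclideanSpace ℝ (Fin N) × ℝ => ENNReal.ofReal (b p.1) :=
    (hb.measurable.comp measurable_fst).ennreal_ofReal
  have e : ‖u‖ = ‖H.energyMap b s u‖ := rfl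
  have n1 : ‖u.memLp_grad.toLp u.grad‖ ^ 2 = ∫ p, ‖u.grad p‖ ^ 2 ∂(weightedVolume N s) := by
    rw [← real_inner_self_eq_norm_sq, L2.inner_def]
    refine integral_congr_ae ?_
    filter_upwards [u.memLp_grad.coeFn_toLp] with p hp
    rw [hp, real_inner_self_eq_norm_sq]
  have n2 : ‖u.memLp_toFun.toLp u.toFun‖ ^ 2 =
      ∫ p, b p.1 * u.toFun p ^ 2 ∂(weightedVolume N s) := by
    rw [← real_inner_self_eq_norm_sq, L2.inner_def]
    have : ∫ p, inner ℝ (u.memLp_toFun.toLp u.toFun p) (u.memLp_toFun.toLp u.toFun p)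
        ∂(potentialVolume b s) = ∫ p, u.toFun p ^ 2 ∂(potentialVolume b s) := by
      refine integral_congr_ae ?_
      filter_upwards [u.memLp_toFun.coeFn_toLp] with p hp
      rw [hp, real_inner_self_eq_norm_sq, Real.norm_eq_abs, sq_abs]
    rw [this, potentialVolume, integral_withDensity_eq_integral_toReal_smul hm (by simp)]
    simp [ENNReal.toReal_ofReal (hb0 _)]
  have i1 : Integrable (fun p => ‖u.grad p‖ ^ 2) (weightedVolume N s) :=
    (memLp_two_iff_integrable_sq_norm u.memLp_grad.1).1 u.memLp_grad
  have i2 : Integrable (fun p => b p.1 * u.toFun p ^ 2) (weightedVolume N s) := by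
    have := (memLp_two_iff_integrable_sq u.memLp_toFun.1).1 u.memLp_toFun
    rw [potentialVolume, integrable_withDensity_iff hm (by simp)] at this
    simpa [ENNReal.toReal_ofReal (hb0 _), mul_comm] using this
  rw [← integral_weightedVolume, integral_add i1 i2, ← n1, ← n2, e,
    WithLp.prod_norm_sq_eq_of_L2, add_comm]
  rfl

/-- `g` is the trace of `u` on `ℝ^N × {0}`: `u(·, t) → g` in `L²(ℝ^N)` as `t ↓ 0`, the limit
being taken along almost every `t`, so that it does not depend on the representative of `u`. -/
def IsTrace (u : EuclideanSpace ℝ (Fin N) × ℝ → ℝ) (g : EuclideanSpace ℝ (Fin N) → ℝ) : Prop :=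
  Tendsto (fun t : ℝ => eLpNorm (fun x => u (x, t) - g x) 2 volume) (𝓝[>] 0 ⊓ ae volume) (𝓝 0)

end ExtensionSpace

end

/-! Slices near the boundary are approximated, uniformly on bounded sets of the energy space, by
compact operators; their operator norm limit is the trace, hence compact.

Fix a scale `ε` and a height `t < ε / 2`, and compare `u(x, t)` with `u(x + z, τ)` for `|z| < ε` and
`ε < τ ≤ 2ε`. A weak gradient integrates along almost every oblique segment joining the two points
(`IsWeakGradient.ae_sub_eq_integral`). Cauchy–Schwarz against the weight `τ^(1-2s)`, whose
reciprocal is integrable at `0` because `s > 0`, bounds the squared `L²` distance in `x` by a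
multiple of `ε^(2s)` times the gradient energy, uniformly in `t`
(`IsWeakGradient.ae_lintegral_slice_sub_le`).

Now average `u(x + z, τ)` over `(z, τ)` with a weight of mass one, after cutting `u` off outside the
strip over `A = {b ≤ M}`. The discarded part lies where `b > M`, so the potential energy makes it
small for large `M` (`lintegral_sub_average_le`). What remains is an integral operator over a strip
of finite measure, with square integrable kernel: it is Hilbert–Schmidt, hence compact
(`exists_compact_approx`). Letting `ε` tend to `0` gives the trace (`exists_trace_of_approx`). -/

noncomputable section

namespace ExtensionSpace

/-! ### Compactness of Hilbert–Schmidt operators -/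

section Kernel

variable {X F : Type*} [MeasurableSpace X] {μ : Measure X} [NormedAddCommGroup F]
  [InnerProductSpace ℝ F]

/-- The operator `v ↦ (x ↦ ⟪v, f x⟫)` from `F` to `L²(X)` with kernel `f ∈ L²(X; F)`. -/
def kernelOperator (f : Lp F 2 μ) : F →L[ℝ] Lp ℝ 2 μ :=
  (((innerSL ℝ : F →L[ℝ] F →L[ℝ] ℝ).compLpL₂ 2 μ).flip) f

lemma coeFn_kernelOperator (f : Lp F 2 μ) (v : F) :
    kernelOperator f v =ᵐ[μ] fun x => inner ℝ v (f x) :=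
  ContinuousLinearMap.coeFn_compLp (innerSL ℝ v) f

/-- Hilbert–Schmidt operators are compact. -/
lemma isCompactOperator_kernelOperator (f : Lp F 2 μ) : IsCompactOperator (kernelOperator f) := by
  -- Density of simple kernels: the kernel `c 1_A` gives a rank one operator, and the kernel
  -- determines the operator continuously and linearly, so closedness of the compact operators in
  -- operator norm covers every kernel.
  induction f using Lp.induction (ENNReal.ofNat_ne_top : (2 : ℝ≥0∞) ≠ ⊤) with
  | @indicatorConst c A hs hμs =>
    have : (kernelOperator (indicatorConstLp 2 hs hμs.ne c : Lp F 2 μ) : F → Lp ℝ 2 μ) =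
        (ContinuousLinearMap.toSpanSingleton ℝ (indicatorConstLp 2 hs hμs.ne (1 : ℝ))) ∘
          (innerSL ℝ c) := by
      funext v
      refine Lp.ext ?_
      refine (coeFn_kernelOperator _ v).trans ?_
      simp only [Function.comp_apply, ContinuousLinearMap.toSpanSingleton_apply, innerSL_apply_apply]
      filter_upwards [indicatorConstLp_coeFn (p := 2) (hs := hs) (hμs := hμs.ne) (c := c),
        indicatorConstLp_coeFn (p := 2) (hs := hs) (hμs := hμs.ne) (c := (1 : ℝ)),
        Lp.coeFn_smul (inner ℝ c v) (indicatorConstLp 2 hs hμs.ne (1 : ℝ))] with x h1 h2 h3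
      rw [h1, h3, Pi.smul_apply, h2]
      by_cases hx : x ∈ A <;> simp [Set.indicator, hx, real_inner_comm]
    rw [Lp.simpleFunc.coe_indicatorConst, this]
    exact (isCompactOperator_of_locallyCompactSpace_dom (innerSL ℝ c)).clm_comp _
  | add hf hg _ h1 h2 =>
    have := h1.add h2
    unfold kernelOperator at this ⊢
    rwa [map_add]
  | isClosed =>
    exact isClosed_setOfPred_isCompactOperator.preimage (ContinuousLinearMap.continuous
      ((innerSL ℝ : F →L[ℝ] F →L[ℝ] ℝ).compLpL₂ 2 μ).flip)

end Kernel

/-! ### Traces as limits of compact operators -/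

variable {N : ℕ} {b : EuclideanSpace ℝ (Fin N) → ℝ} {s : ℝ}

lemma H.stronglyMeasurable_toFun (u : H b s) : StronglyMeasurable u.toFun :=
  Lp.stronglyMeasurable _

lemma H.aestronglyMeasurable_slice (u : H b s) (t : ℝ) :
    AEStronglyMeasurable (fun x => u.toFun (x, t)) volume :=
  (u.stronglyMeasurable_toFun.comp_measurable
    (measurable_id.prodMk measurable_const)).aestronglyMeasurable

/-- Intervals `(0, ε)` have positive measure, so they meet every conull set. This is what makes
trace limits unique and lets finitely many eventual estimates share a height `t`. -/
instance neBot_traceFilter : (𝓝[>] (0 : ℝ) ⊓ ae volume).NeBot := by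
  rw [inf_neBot_iff]
  intro A hA B hB
  obtain ⟨ε, hε, hεA⟩ := mem_nhdsGT_iff_exists_Ioo_subset.1 hA
  by_contra hne
  have hsub : Ioo 0 ε ⊆ Bᶜ := fun t ht hB => hne ⟨t, hεA ht, hB⟩
  have h0 : volume (Ioo 0 ε) = 0 := measure_mono_null hsub (mem_ae_iff.1 hB)
  simp only [Real.volume_Ioo, sub_zero, ENNReal.ofReal_eq_zero] at h0
  exact absurd hε (not_lt.2 h0)

lemma IsTrace.unique {u : H b s} {g g' : Lp ℝ 2 (volume : Measure (EuclideanSpace ℝ (Fin N)))}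
    (h : IsTrace u.toFun g) (h' : IsTrace u.toFun g') : g = g' := by
  unfold IsTrace at h h'
  have h0 : eLpNorm (fun x => g x - g' x) 2 volume = 0 := by
    refine le_antisymm (ge_of_tendsto (by simpa using h.add h') (Eventually.of_forall fun t => ?_))
      zero_le
    rw [add_comm]
    have := eLpNorm_sub_le (((u.aestronglyMeasurable_slice t)).sub (Lp.aestronglyMeasurable g'))
      (((u.aestronglyMeasurable_slice t)).sub (Lp.aestronglyMeasurable g)) (p := 2) (by simp)
    refine le_trans (le_of_eq ?_) this
    congr 1
    funext x
    simp
  replace h0 := (eLpNorm_eq_zero_iff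
    ((Lp.aestronglyMeasurable g).sub (Lp.aestronglyMeasurable g')) two_ne_zero).1 h0
  refine Lp.ext ?_
  filter_upwards [h0] with x hx
  exact sub_eq_zero.1 hx

/-- A uniform approximation of the slices `u(·, t)` for small `t` by compact operators
yields a compact trace operator. -/
theorem exists_trace_of_approx
    (K : ℕ → H b s →L[ℝ] Lp ℝ 2 (volume : Measure (EuclideanSpace ℝ (Fin N))))
    (hK : ∀ n, IsCompactOperator (K n)) (δ : ℕ → ℝ) (hδ0 : ∀ n, 0 ≤ δ n)
    (hδ : Tendsto δ atTop (𝓝 0))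
    (h : ∀ n (u : H b s), ∀ᶠ t in 𝓝[>] (0 : ℝ) ⊓ ae volume,
      eLpNorm (fun x => u.toFun (x, t) - K n u x) 2 volume ≤ ENNReal.ofReal (δ n * ‖u‖)) :
    ∃ T : H b s →L[ℝ] Lp ℝ 2 (volume : Measure (EuclideanSpace ℝ (Fin N))),
      (∀ (u : H b s) (g : Lp ℝ 2 (volume : Measure (EuclideanSpace ℝ (Fin N)))),
        IsTrace u.toFun g ↔ T u = g) ∧ IsCompactOperator T := by
  -- Both operators are compared with the same slice `u(·, t)`, so the Cauchy property needs no
  -- trace beforehand.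
  have hdist : ∀ n m, ‖K n - K m‖ ≤ δ n + δ m := fun n m => by
    refine ContinuousLinearMap.opNorm_le_bound _ (add_nonneg (hδ0 n) (hδ0 m)) fun u => ?_
    obtain ⟨t, h1, h2⟩ := ((h n u).and (h m u)).exists
    have := eLpNorm_sub_le (((u.aestronglyMeasurable_slice t)).sub (Lp.aestronglyMeasurable (K m u)))
      (((u.aestronglyMeasurable_slice t)).sub (Lp.aestronglyMeasurable (K n u))) (p := 2) (by simp)
    rw [_root_.sub_apply, Lp.norm_def]
    refine ENNReal.toReal_le_of_le_ofReal (by have := hδ0 n; have := hδ0 m; positivity) ?_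
    rw [add_mul, add_comm, ENNReal.ofReal_add (by have := hδ0 m; positivity)
      (by have := hδ0 n; positivity)]
    refine le_trans (le_of_eq ?_) (this.trans (add_le_add h2 h1))
    refine eLpNorm_congr_ae ?_
    filter_upwards [Lp.coeFn_sub (K n u) (K m u)] with x hx
    rw [hx]
    simp
  have hc : CauchySeq K := by
    rw [Metric.cauchySeq_iff]
    intro ε hε
    obtain ⟨n₀, hn₀⟩ := eventually_atTop.1 (hδ.eventually (gt_mem_nhds (half_pos hε)))
    refine ⟨n₀, fun n hn m hm => ?_⟩
    rw [dist_eq_norm]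
    linarith [hdist n m, hn₀ n hn, hn₀ m hm]
  obtain ⟨T, hT⟩ := cauchySeq_tendsto_of_complete hc
  have hTn : ∀ n, ‖T - K n‖ ≤ δ n := fun n => by
    have h1 : Tendsto (fun m => ‖K m - K n‖) atTop (𝓝 ‖T - K n‖) := (hT.sub_const _).norm
    have h2 : Tendsto (fun m => δ m + δ n) atTop (𝓝 (0 + δ n)) := hδ.add_const _
    rw [zero_add] at h2
    exact le_of_tendsto_of_tendsto' h1 h2 fun m => hdist m n
  have htr : ∀ u, IsTrace u.toFun (T u) := fun u => by
    unfold IsTrace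
    rw [ENNReal.tendsto_nhds_zero]
    intro ε hε
    have h2 : Tendsto (fun n => ENNReal.ofReal (δ n * ‖u‖) + ENNReal.ofReal (δ n * ‖u‖)) atTop
        (𝓝 0) := by
      have : Tendsto (fun n => ENNReal.ofReal (δ n * ‖u‖)) atTop (𝓝 0) := by
        simpa using ENNReal.tendsto_ofReal (hδ.mul_const ‖u‖)
      simpa using this.add this
    obtain ⟨n, hn⟩ := ((ENNReal.tendsto_nhds_zero.1 h2) ε hε).exists
    filter_upwards [h n u] with t ht
    refine le_trans ?_ hn
    -- The slice is within `δ n * ‖u‖` of `K n u`, which is within `δ n * ‖u‖` of `T u`.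
    have hd : eLpNorm (fun x => T u x - K n u x) 2 volume ≤ ENNReal.ofReal (δ n * ‖u‖) := by
      have h3 : ‖(T - K n) u‖ ≤ δ n * ‖u‖ :=
        (ContinuousLinearMap.le_opNorm _ u).trans (by gcongr; exact hTn n)
      rw [_root_.sub_apply, Lp.norm_def] at h3
      refine (eLpNorm_congr_ae (Lp.coeFn_sub (T u) (K n u))).ge.trans ?_
      rw [← ENNReal.ofReal_toReal (Lp.eLpNorm_ne_top (T u - K n u))]
      exact ENNReal.ofReal_le_ofReal h3
    have := eLpNorm_sub_le (((u.aestronglyMeasurable_slice t)).sub (Lp.aestronglyMeasurable (K n u)))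
      ((Lp.aestronglyMeasurable (T u)).sub (Lp.aestronglyMeasurable (K n u))) (p := 2) (by simp)
    refine le_trans (le_of_eq ?_) (this.trans (add_le_add ht hd))
    congr 1
    funext x
    simp
  refine ⟨T, fun u g => ⟨fun hg => (htr u).unique hg, fun hg => hg ▸ htr u⟩, ?_⟩
  exact isCompactOperator_of_tendsto hT (Eventually.of_forall hK)

end ExtensionSpace
end

/-! ### Weak gradients integrate along almost every segment -/

noncomputable section

namespace ExtensionSpace

variable {N : ℕ}

instance isAddRightInvariant_volume :
    (volume : Measure (EuclideanSpace ℝ (Fin N) × ℝ)).IsAddRightInvariant := by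
  have : (volume : Measure (EuclideanSpace ℝ (Fin N) × ℝ)).IsAddLeftInvariant :=
    inferInstanceAs ((volume : Measure (EuclideanSpace ℝ (Fin N))).prod
      (volume : Measure ℝ)).IsAddLeftInvariant
  infer_instance

lemma locallyIntegrableOn_halfSpace_iff {F : Type*} [NormedAddCommGroup F]
    {f : EuclideanSpace ℝ (Fin N) × ℝ → F} :
    LocallyIntegrableOn f (halfSpace N) ↔
      ∀ K ⊆ halfSpace N, IsCompact K → IntegrableOn f K :=
  locallyIntegrableOn_iff (isOpen_halfSpace N).isLocallyClosed

/-- Permits replacing the gradient by a strongly measurable representative, so that its composition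
with translations is measurable. -/
lemma IsWeakGradient.congr_right {u : EuclideanSpace ℝ (Fin N) × ℝ → ℝ}
    {G G' : EuclideanSpace ℝ (Fin N) × ℝ → GradVal N} (h : IsWeakGradient u G)
    (hG : G =ᵐ[halfVolume N] G') : IsWeakGradient u G' := by
  refine ⟨locallyIntegrableOn_halfSpace_iff.2 fun K hK hKc => ?_, fun φ hφ hc hs v => ?_⟩
  · exact (locallyIntegrableOn_halfSpace_iff.1 h.1 K hK hKc).congr
      (ae_mono (Measure.restrict_mono hK le_rfl) hG)
  · rw [h.2 φ hφ hc hs v]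
    congr 1
    refine integral_congr_ae ?_
    filter_upwards [hG] with p hp
    rw [hp]

lemma locallyIntegrableOn_halfSpace_of_memLp {u : EuclideanSpace ℝ (Fin N) × ℝ → ℝ}
    (hu : MemLp u 2 (halfVolume N)) : LocallyIntegrableOn u (halfSpace N) := by
  refine locallyIntegrableOn_halfSpace_iff.2 fun K hK hKc => ?_
  have h1 : MemLp u 2 (volume.restrict K) := hu.mono_measure (Measure.restrict_mono hK le_rfl)
  have : IsFiniteMeasure (volume.restrict K) := ⟨by simpa using hKc.measure_lt_top⟩
  exact h1.integrable (by norm_num)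

/-- The union of the translates `K + r w`, `r ∈ [0, 1]`. -/
def sweep (K : Set (EuclideanSpace ℝ (Fin N) × ℝ)) (w : EuclideanSpace ℝ (Fin N) × ℝ) :
    Set (EuclideanSpace ℝ (Fin N) × ℝ) :=
  (fun z : (EuclideanSpace ℝ (Fin N) × ℝ) × ℝ => z.1 + z.2 • w) '' (K ×ˢ Icc 0 1)

lemma isCompact_sweep {K : Set (EuclideanSpace ℝ (Fin N) × ℝ)} (hK : IsCompact K)
    (w : EuclideanSpace ℝ (Fin N) × ℝ) : IsCompact (sweep K w) :=
  (hK.prod isCompact_Icc).image (by fun_prop)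

lemma add_smul_mem_halfSpace {p w : EuclideanSpace ℝ (Fin N) × ℝ} (hp : p ∈ halfSpace N)
    (hw : 0 ≤ w.2) {r : ℝ} (hr : 0 ≤ r) : p + r • w ∈ halfSpace N := by
  refine ⟨mem_univ _, ?_⟩
  have : 0 < p.2 := hp.2
  simp only [Prod.snd_add, Prod.smul_snd, smul_eq_mul, mem_Ioi]
  positivity

lemma sweep_subset {K : Set (EuclideanSpace ℝ (Fin N) × ℝ)} (hK : K ⊆ halfSpace N)
    {w : EuclideanSpace ℝ (Fin N) × ℝ} (hw : 0 ≤ w.2) : sweep K w ⊆ halfSpace N := by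
  rintro _ ⟨⟨p, r⟩, ⟨hp, hr⟩, rfl⟩
  exact add_smul_mem_halfSpace (hK hp) hw hr.1

lemma mem_sweep {K : Set (EuclideanSpace ℝ (Fin N) × ℝ)} {q w : EuclideanSpace ℝ (Fin N) × ℝ}
    {r : ℝ} (hr : r ∈ Icc (0 : ℝ) 1) (hq : q - r • w ∈ K) : q ∈ sweep K w :=
  ⟨(q - r • w, r), ⟨hq, hr⟩, by simp⟩

section Fubini

variable {f ψ : EuclideanSpace ℝ (Fin N) × ℝ → ℝ} {K : Set (EuclideanSpace ℝ (Fin N) × ℝ)}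
  {C : ℝ} {w : EuclideanSpace ℝ (Fin N) × ℝ}

/-- The integrand vanishes off the compact set `sweep K w`, so the bound does not depend on `r`;
this supplies the domination for Fubini. -/
lemma lintegral_translate_mul_le (hKc : IsCompact K) (hψC : ∀ p, ‖ψ p‖ ≤ C)
    (hψK : ∀ p ∉ K, ψ p = 0) {r : ℝ} (hr : r ∈ Icc (0 : ℝ) 1) :
    ∫⁻ q, ‖ψ (q - r • w) * f q‖ₑ ≤ ENNReal.ofReal C * ∫⁻ q in sweep K w, ‖f q‖ₑ := by
  rw [← lintegral_const_mul' _ _ ENNReal.ofReal_ne_top,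
    ← lintegral_indicator (isCompact_sweep hKc w).measurableSet]
  refine lintegral_mono fun q => ?_
  by_cases hq : q - r • w ∈ K
  · rw [indicator_of_mem (mem_sweep hr hq), enorm_mul]
    gcongr
    rw [← ofReal_norm]
    exact ENNReal.ofReal_le_ofReal (hψC _)
  · simp [hψK _ hq]

lemma ae_mem_Icc_restrict_Ioc : ∀ᵐ r ∂(volume.restrict (Ioc (0 : ℝ) 1)), r ∈ Icc (0 : ℝ) 1 :=
  (ae_restrict_mem measurableSet_Ioc).mono fun _ h => Ioc_subset_Icc_self h

lemma integrable_translate_mul (hf : StronglyMeasurable f)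
    (hfl : LocallyIntegrableOn f (halfSpace N)) (hψ : StronglyMeasurable ψ) (hKc : IsCompact K)
    (hK : K ⊆ halfSpace N) (hψC : ∀ p, ‖ψ p‖ ≤ C) (hψK : ∀ p ∉ K, ψ p = 0) (hw : 0 ≤ w.2) :
    Integrable (fun z : (EuclideanSpace ℝ (Fin N) × ℝ) × ℝ => ψ (z.1 - z.2 • w) * f z.1)
      (volume.prod (volume.restrict (Ioc 0 1))) := by
  have hm : StronglyMeasurable
      (fun z : (EuclideanSpace ℝ (Fin N) × ℝ) × ℝ => ψ (z.1 - z.2 • w) * f z.1) :=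
    (hψ.comp_measurable (by fun_prop)).mul (hf.comp_measurable (by fun_prop))
  refine ⟨hm.aestronglyMeasurable, ?_⟩
  rw [HasFiniteIntegral, lintegral_prod_symm' _ hm.enorm]
  refine (lintegral_mono_ae (ae_mem_Icc_restrict_Ioc.mono fun r hr =>
    lintegral_translate_mul_le (f := f) (w := w) hKc hψC hψK hr)).trans_lt ?_
  rw [lintegral_const]
  refine ENNReal.mul_lt_top (ENNReal.mul_lt_top ENNReal.ofReal_lt_top ?_) (by simp)
  exact (locallyIntegrableOn_halfSpace_iff.1 hfl _ (sweep_subset hK hw) (isCompact_sweep hKc w)).2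

/-- For each fixed `r`, translation by `r • w` turns the integrand into the one of
`integrable_translate_mul`, with the same inner integral. -/
lemma integrable_mul_translate (hf : StronglyMeasurable f)
    (hfl : LocallyIntegrableOn f (halfSpace N)) (hψ : StronglyMeasurable ψ) (hKc : IsCompact K)
    (hK : K ⊆ halfSpace N) (hψC : ∀ p, ‖ψ p‖ ≤ C) (hψK : ∀ p ∉ K, ψ p = 0) (hw : 0 ≤ w.2) :
    Integrable (fun z : (EuclideanSpace ℝ (Fin N) × ℝ) × ℝ => ψ z.1 * f (z.1 + z.2 • w))
      (volume.prod (volume.restrict (Ioc 0 1))) := by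
  have hm : StronglyMeasurable
      (fun z : (EuclideanSpace ℝ (Fin N) × ℝ) × ℝ => ψ z.1 * f (z.1 + z.2 • w)) :=
    (hψ.comp_measurable (by fun_prop)).mul (hf.comp_measurable (by fun_prop))
  have h := (integrable_translate_mul hf hfl hψ hKc hK hψC hψK hw).2
  refine ⟨hm.aestronglyMeasurable, ?_⟩
  have hm' : StronglyMeasurable
      (fun z : (EuclideanSpace ℝ (Fin N) × ℝ) × ℝ => ψ (z.1 - z.2 • w) * f z.1) :=
    (hψ.comp_measurable (by fun_prop)).mul (hf.comp_measurable (by fun_prop))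
  rw [HasFiniteIntegral, lintegral_prod_symm' _ hm'.enorm] at h
  rw [HasFiniteIntegral, lintegral_prod_symm' _ hm.enorm]
  refine lt_of_eq_of_lt (lintegral_congr fun r => ?_) h
  rw [← lintegral_add_right_eq_self (fun q => ‖ψ (q - r • w) * f q‖ₑ) (r • w)]
  simp

end Fubini

lemma integrable_test_mul {g φ : EuclideanSpace ℝ (Fin N) × ℝ → ℝ}
    (hg : LocallyIntegrableOn g (halfSpace N)) (hφ : ContDiff ℝ ∞ φ) (hc : HasCompactSupport φ)
    (hs : tsupport φ ⊆ halfSpace N) : Integrable (fun p => φ p * g p) := by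
  have h2 : IntegrableOn (fun p => φ p • g p) (tsupport φ) :=
    (hg.integrableOn_compact_subset hs hc).continuousOn_smul hφ.continuous.continuousOn hc
  refine (integrableOn_iff_integrable_of_support_subset fun p hp => ?_).1 h2
  exact subset_tsupport φ fun h => hp (by simp [h])

/-- Integration by parts against the translates of a test function, averaged over a segment. -/
lemma IsWeakGradient.integral_test_mul_segment {u : EuclideanSpace ℝ (Fin N) × ℝ → ℝ}
    {G : EuclideanSpace ℝ (Fin N) × ℝ → GradVal N} (h : IsWeakGradient u G)
    (hu : StronglyMeasurable u) (hul : LocallyIntegrableOn u (halfSpace N))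
    (hG : StronglyMeasurable G) {w : EuclideanSpace ℝ (Fin N) × ℝ} (hw : 0 ≤ w.2)
    {φ : EuclideanSpace ℝ (Fin N) × ℝ → ℝ} (hφ : ContDiff ℝ ∞ φ) (hc : HasCompactSupport φ)
    (hs : tsupport φ ⊆ halfSpace N) :
    ∫ p, φ p * ∫ r in Ioc (0 : ℝ) 1, inner ℝ (WithLp.toLp 2 w) (G (p + r • w)) =
      ∫ q, u q * (φ (q - w) - φ q) := by
  have hf : StronglyMeasurable fun p => inner ℝ (WithLp.toLp 2 w) (G p) :=
    stronglyMeasurable_const.inner hG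
  have hfl : LocallyIntegrableOn (fun p => inner ℝ (WithLp.toLp 2 w) (G p)) (halfSpace N) :=
    locallyIntegrableOn_halfSpace_iff.2 fun K hK hKc =>
      (locallyIntegrableOn_halfSpace_iff.1 h.1 K hK hKc).const_inner _
  have hzero : ∀ p ∉ tsupport φ, φ p = 0 := fun p hp => image_eq_zero_of_notMem_tsupport hp
  have hd : Continuous fun p => fderiv ℝ φ p w :=
    (hφ.continuous_fderiv (by simp)).clm_apply continuous_const
  have hdzero : ∀ p ∉ tsupport φ, fderiv ℝ φ p w = 0 := fun p hp => by
    rw [image_eq_zero_of_notMem_tsupport fun h => hp (tsupport_fderiv_subset ℝ h)]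
    simp
  obtain ⟨C, hC⟩ := hφ.continuous.bounded_above_of_compact_support hc
  obtain ⟨C', hC'⟩ := hd.bounded_above_of_compact_support (hc.fderiv_apply (𝕜 := ℝ) w)
  have hmem : ∀ r : ℝ, 0 ≤ r → ∀ q, φ (q - r • w) ≠ 0 → q ∈ halfSpace N := fun r hr q hq => by
    have : q - r • w ∈ halfSpace N := by
      by_contra hn
      exact hq (hzero _ fun h => hn (hs h))
    simpa using add_smul_mem_halfSpace this hw hr
  have step : ∀ r ∈ Ioc (0 : ℝ) 1,
      ∫ p, φ p * inner ℝ (WithLp.toLp 2 w) (G (p + r • w)) =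
        - ∫ q, fderiv ℝ φ (q - r • w) w * u q := fun r hr => by
    -- Translation moves the support upwards since `0 ≤ w.2`, so the translate is still an
    -- admissible test function.
    have hts : tsupport (fun q => φ (q - r • w)) ⊆ halfSpace N := by
      have h1 : tsupport (fun q => φ (q - r • w)) ⊆ (fun q => q - r • w) ⁻¹' tsupport φ :=
        closure_minimal (fun q hq => subset_tsupport φ hq)
          ((isClosed_tsupport φ).preimage (by fun_prop))
      intro q hq
      simpa using add_smul_mem_halfSpace (hs (h1 hq)) hw hr.1.le
    have hcomp : HasCompactSupport (fun q => φ (q - r • w)) := by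
      simpa [Function.comp_def, sub_eq_add_neg] using
        hc.comp_homeomorph (Homeomorph.addRight (-(r • w)))
    have h2 := h.2 (fun q => φ (q - r • w)) (hφ.comp (contDiff_id.sub contDiff_const)) hcomp hts w
    simp only [fderiv_comp_sub] at h2
    rw [setIntegral_eq_integral_of_forall_compl_eq_zero,
      setIntegral_eq_integral_of_forall_compl_eq_zero] at h2
    · rw [← integral_sub_right_eq_self _ (r • w)]
      simp only [sub_add_cancel]
      rw [eq_neg_iff_add_eq_zero, add_comm, ← eq_neg_iff_add_eq_zero, ← h2]
      exact integral_congr_ae (Eventually.of_forall fun q => mul_comm _ _)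
    · intro q hq
      by_contra hne
      exact hq (hmem r hr.1.le q fun h0 => hne (by simp [h0]))
    · intro q hq
      have : q - r • w ∉ tsupport φ := fun hmm => hq (by
        simpa using add_smul_mem_halfSpace (hs hmm) hw hr.1.le)
      simp [hdzero _ this]
  have ftc : ∀ q, ∫ r in Ioc (0 : ℝ) 1, fderiv ℝ φ (q - r • w) w = φ q - φ (q - w) := fun q => by
    rw [← intervalIntegral.integral_of_le zero_le_one]
    have : ∀ r ∈ uIcc (0 : ℝ) 1,
        HasDerivAt (fun r : ℝ => - φ (q - r • w)) (fderiv ℝ φ (q - r • w) w) r := fun r _ => by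
      have h1 : HasDerivAt (fun r : ℝ => q - r • w) (-w) r := by
        simpa using ((hasDerivAt_id r).smul_const w).const_sub q
      have h2 := ((hφ.differentiable (by simp)) (q - r • w)).hasFDerivAt.comp_hasDerivAt r h1
      simpa [Function.comp_def] using h2.fun_neg
    rw [intervalIntegral.integral_eq_sub_of_hasDerivAt this
      ((hd.comp (by fun_prop)).intervalIntegrable _ _)]
    simp only [one_smul, zero_smul, sub_zero]
    ring
  have hswap := integral_integral_swap (μ := volume) (ν := volume.restrict (Ioc (0 : ℝ) 1))
    (f := fun p r => φ p * inner ℝ (WithLp.toLp 2 w) (G (p + r • w))) (integrable_mul_translate hf hfl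
    hφ.continuous.stronglyMeasurable hc hs hC hzero hw)
  have hswap' := integral_integral_swap (μ := volume) (ν := volume.restrict (Ioc (0 : ℝ) 1))
    (f := fun q r => fderiv ℝ φ (q - r • w) w * u q) (integrable_translate_mul hu hul
    hd.stronglyMeasurable hc hs hC' hdzero hw)
  simp only [integral_const_mul] at hswap
  rw [hswap, setIntegral_congr_fun measurableSet_Ioc step, integral_neg, ← hswap',
    ← integral_neg]
  refine integral_congr_ae (Eventually.of_forall fun q => ?_)
  simp only [integral_mul_const, ftc]
  ring

/-- A function with weak gradient `G` satisfies the fundamental theorem of calculus along almost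
every segment with a given direction `w`. -/
theorem IsWeakGradient.ae_sub_eq_integral {u : EuclideanSpace ℝ (Fin N) × ℝ → ℝ}
    {G : EuclideanSpace ℝ (Fin N) × ℝ → GradVal N} (h : IsWeakGradient u G)
    (hu : StronglyMeasurable u) (hul : LocallyIntegrableOn u (halfSpace N))
    (hG : StronglyMeasurable G) {w : EuclideanSpace ℝ (Fin N) × ℝ} (hw : 0 ≤ w.2) :
    ∀ᵐ p ∂(halfVolume N), u (p + w) - u p =
      ∫ r in Ioc (0 : ℝ) 1, inner ℝ (WithLp.toLp 2 w) (G (p + r • w)) := by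
  set f : EuclideanSpace ℝ (Fin N) × ℝ → ℝ := fun p => inner ℝ (WithLp.toLp 2 w) (G p)
  have hf : StronglyMeasurable f := stronglyMeasurable_const.inner hG
  have hfl : LocallyIntegrableOn f (halfSpace N) :=
    locallyIntegrableOn_halfSpace_iff.2 fun K hK hKc =>
      (locallyIntegrableOn_halfSpace_iff.1 h.1 K hK hKc).const_inner _
  have huw : LocallyIntegrableOn (fun p => u (p + w)) (halfSpace N) := by
    refine locallyIntegrableOn_halfSpace_iff.2 fun K hK hKc => ?_
    have h1 : IntegrableOn u ((fun p => p + w) '' K) := by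
      refine locallyIntegrableOn_halfSpace_iff.1 hul _ ?_ (hKc.image (by fun_prop))
      rintro _ ⟨p, hp, rfl⟩
      simpa using add_smul_mem_halfSpace (hK hp) hw zero_le_one
    exact ((measurePreserving_add_right volume w).integrableOn_image
      (measurableEmbedding_addRight w)).1 h1
  have hJl : LocallyIntegrableOn (fun p => ∫ r in Ioc (0 : ℝ) 1, f (p + r • w)) (halfSpace N) := by
    refine locallyIntegrableOn_halfSpace_iff.2 fun K hK hKc => ?_
    -- Fubini with the indicator of `K` in place of a test function gives integrability on `K` of
    -- the segment integral.
    have h1 := (integrable_mul_translate (ψ := K.indicator 1) (C := 1) hf hfl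
      (stronglyMeasurable_one.indicator hKc.measurableSet) hKc hK
      (fun p => by by_cases hp : p ∈ K <;> simp [hp])
      (fun p hp => by simp [hp]) hw).integral_prod_left
    rw [← integrable_indicator_iff hKc.measurableSet]
    refine h1.congr (Eventually.of_forall fun p => ?_)
    by_cases hp : p ∈ K <;> simp [hp]
  have key := (isOpen_halfSpace N).ae_eq_zero_of_integral_contDiff_smul_eq_zero
    (μ := volume) ((huw.sub hul).sub hJl) fun φ hφ hc hs => by
      have i1 := integrable_test_mul huw hφ hc hs
      have i2 := integrable_test_mul hul hφ hc hs
      have i3 := integrable_test_mul hJl hφ hc hs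
      have i12 : Integrable (fun p => φ p * u (p + w) - φ p * u p) := i1.sub i2
      have i1' : Integrable (fun q => φ (q - w) * u q) := by
        simpa using i1.comp_sub_right w
      have e := h.integral_test_mul_segment hu hul hG hw hφ hc hs
      simp only [Pi.sub_apply, smul_eq_mul, mul_sub]
      rw [integral_sub i12 i3, integral_sub i1 i2, e,
        ← integral_sub_right_eq_self (fun p => φ p * u (p + w)) w]
      simp only [sub_add_cancel]
      rw [← integral_sub i1' i2, sub_eq_zero]
      refine integral_congr_ae (Eventually.of_forall fun q => ?_)
      ring
  unfold halfVolume
  rw [ae_restrict_iff' (isOpen_halfSpace N).measurableSet]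
  filter_upwards [key] with p hp hmem
  exact sub_eq_zero.1 (hp hmem)

end ExtensionSpace
end

/-! ### Weighted estimates for differences of slices -/

noncomputable section

namespace ExtensionSpace

/-- Cauchy–Schwarz for the splitting `f = √m * (f / √m)`. -/
lemma lintegral_sq_le_mul {α : Type*} [MeasurableSpace α] {μ : Measure α} {m : α → ℝ}
    {f : α → ℝ≥0∞} (hm : AEMeasurable m μ) (hm0 : ∀ᵐ a ∂μ, 0 < m a) (hf : AEMeasurable f μ) :
    (∫⁻ a, f a ∂μ) ^ 2 ≤
      (∫⁻ a, ENNReal.ofReal (m a) ∂μ) * ∫⁻ a, ENNReal.ofReal (m a)⁻¹ * f a ^ 2 ∂μ := by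
  have h := ENNReal.lintegral_mul_le_Lp_mul_Lq μ Real.HolderConjugate.two_two
    (f := fun a => ENNReal.ofReal √(m a)) (g := fun a => ENNReal.ofReal (√(m a))⁻¹ * f a)
    (by fun_prop) (by fun_prop)
  have e1 : ∫⁻ a, f a ∂μ = ∫⁻ a, ((fun a => ENNReal.ofReal √(m a)) *
      fun a => ENNReal.ofReal (√(m a))⁻¹ * f a) a ∂μ := by
    refine lintegral_congr_ae ?_
    filter_upwards [hm0] with a ha
    have : 0 < √(m a) := Real.sqrt_pos.2 ha
    rw [Pi.mul_apply, ← mul_assoc, ← ENNReal.ofReal_mul this.le, mul_inv_cancel₀ this.ne']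
    simp
  have e2 : ∫⁻ a, ENNReal.ofReal √(m a) ^ (2 : ℝ) ∂μ = ∫⁻ a, ENNReal.ofReal (m a) ∂μ := by
    refine lintegral_congr_ae ?_
    filter_upwards [hm0] with a ha
    rw [ENNReal.rpow_two, ← ENNReal.ofReal_pow (Real.sqrt_nonneg _), Real.sq_sqrt ha.le]
  have e3 : ∫⁻ a, (ENNReal.ofReal (√(m a))⁻¹ * f a) ^ (2 : ℝ) ∂μ =
      ∫⁻ a, ENNReal.ofReal (m a)⁻¹ * f a ^ 2 ∂μ := by
    refine lintegral_congr_ae ?_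
    filter_upwards [hm0] with a ha
    rw [ENNReal.rpow_two, mul_pow, ← ENNReal.ofReal_pow (by positivity), inv_pow,
      Real.sq_sqrt ha.le]
  rw [e1]
  refine (pow_le_pow_left' h 2).trans_eq ?_
  rw [e2, e3, mul_pow, ← ENNReal.rpow_two, ← ENNReal.rpow_two, ← ENNReal.rpow_mul,
    ← ENNReal.rpow_mul]
  norm_num

lemma lintegral_sq_le {α : Type*} [MeasurableSpace α] {μ : Measure α}
    {f : α → ℝ≥0∞} (hf : AEMeasurable f μ) :
    (∫⁻ a, f a ∂μ) ^ 2 ≤ μ univ * ∫⁻ a, f a ^ 2 ∂μ := by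
  simpa using lintegral_sq_le_mul (m := fun _ => 1) aemeasurable_const
    (Eventually.of_forall fun _ => one_pos) hf

lemma lintegral_segment (F : ℝ → ℝ≥0∞) (hF : Measurable F) (t : ℝ) {h : ℝ} (hh : 0 < h) :
    ∫⁻ r in Ioc (0 : ℝ) 1, F (t + r * h) =
      ENNReal.ofReal h⁻¹ * ∫⁻ τ in Ioc t (t + h), F τ := by
  have h1 : ∀ r, (Ioc (0 : ℝ) 1).indicator (fun r => F (t + r * h)) r =
      ((Ioc t (t + h)).indicator F) (t + r * h) := fun r => by
    have : r ∈ Ioc (0 : ℝ) 1 ↔ t + r * h ∈ Ioc t (t + h) := by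
      simp only [mem_Ioc, lt_add_iff_pos_right, add_le_add_iff_left]
      refine and_congr ⟨fun h0 => by positivity, fun h0 => pos_of_mul_pos_left h0 hh.le⟩ ?_
      exact ⟨fun h0 => by nlinarith, fun h0 => le_of_mul_le_mul_right (by linarith) hh⟩
    by_cases hr : r ∈ Ioc (0 : ℝ) 1
    · rw [indicator_of_mem hr, indicator_of_mem (this.1 hr)]
    · rw [indicator_of_notMem hr, indicator_of_notMem (mt this.2 hr)]
  have hm : Measurable ((Ioc t (t + h)).indicator F) := hF.indicator measurableSet_Ioc
  rw [← lintegral_indicator measurableSet_Ioc, ← lintegral_indicator measurableSet_Ioc,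
    lintegral_congr h1, ← lintegral_add_left_eq_self ((Ioc t (t + h)).indicator F) t,
    ← lintegral_map (f := fun y => (Ioc t (t + h)).indicator F (t + y)) (by fun_prop)
      (measurable_mul_const h), Real.map_volume_mul_right hh.ne', lintegral_smul_measure,
    abs_of_pos (inv_pos.2 hh), smul_eq_mul]

/-- Since `2s - 1 > -1`, the reciprocal weight is integrable at `0`; dropping `t ^ (2 * s)` leaves a
bound that stays finite as `t ↓ 0`. -/
lemma lintegral_rpow_le {s : ℝ} (hs : 0 < s) {t h : ℝ} (ht : 0 < t) (hh : 0 < h) :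
    ∫⁻ τ in Ioc t (t + h), ENNReal.ofReal (τ ^ (2 * s - 1)) ≤
      ENNReal.ofReal ((t + h) ^ (2 * s) / (2 * s)) := by
  have hi : IntervalIntegrable (fun τ : ℝ => τ ^ (2 * s - 1)) volume t (t + h) :=
    intervalIntegral.intervalIntegrable_rpow' (by linarith)
  rw [← ofReal_integral_eq_lintegral_ofReal
    ((intervalIntegrable_iff_integrableOn_Ioc_of_le (by linarith)).1 hi)
    ((ae_restrict_mem measurableSet_Ioc).mono fun τ hτ => Real.rpow_nonneg (ht.trans hτ.1).le _),
    ← intervalIntegral.integral_of_le (by linarith), integral_rpow (Or.inl (by linarith))]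
  refine ENNReal.ofReal_le_ofReal ?_
  rw [sub_add_cancel]
  gcongr
  have := Real.rpow_nonneg ht.le (2 * s)
  linarith

lemma ae_ae_of_ae_prod_right {α β : Type*} [MeasurableSpace α] [MeasurableSpace β]
    {μ : Measure α} {ν : Measure β} [SFinite μ] [SFinite ν] {P : α × β → Prop}
    (h : ∀ᵐ z ∂(μ.prod ν), P z) : ∀ᵐ y ∂ν, ∀ᵐ x ∂μ, P (x, y) :=
  Measure.ae_ae_of_ae_prod (p := fun z : β × α => P z.swap)
    (Measure.measurePreserving_swap.quasiMeasurePreserving.ae h)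

variable {N : ℕ}

lemma halfVolume_eq_prod (N : ℕ) :
    halfVolume N = (volume : Measure (EuclideanSpace ℝ (Fin N))).prod
      (volume.restrict (Ioi (0 : ℝ))) := by
  rw [halfVolume, halfSpace, Measure.volume_eq_prod, ← Measure.prod_restrict,
    Measure.restrict_univ]

lemma lintegral_weightedVolume (s : ℝ) {f : EuclideanSpace ℝ (Fin N) × ℝ → ℝ≥0∞}
    (hf : Measurable f) : ∫⁻ p, f p ∂(weightedVolume N s) =
      ∫⁻ t in Ioi (0 : ℝ), ENNReal.ofReal (t ^ (1 - 2 * s)) * ∫⁻ x, f (x, t) := by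
  rw [weightedVolume, lintegral_withDensity_eq_lintegral_mul _ (by fun_prop) hf,
    halfVolume_eq_prod, lintegral_prod_symm' _ (by fun_prop)]
  refine lintegral_congr fun t => ?_
  simp only [Pi.mul_apply]
  rw [lintegral_const_mul _ (by fun_prop)]

/-- Both Cauchy–Schwarz factors are integrals over the segment parameter; rewriting each in terms of
the height `τ = t + r * w.2` costs a factor `w.2⁻¹`, whence `(w.2 ^ 2)⁻¹`. Only `w.2 > 0` matters,
so oblique segments cost no more than the factor `|w|²`. -/
lemma lintegral_slice_sub_le {s : ℝ} (hs : 0 < s) {u : EuclideanSpace ℝ (Fin N) × ℝ → ℝ}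
    {G : EuclideanSpace ℝ (Fin N) × ℝ → GradVal N} (hG : StronglyMeasurable G)
    {w : EuclideanSpace ℝ (Fin N) × ℝ} (hw : 0 < w.2) {t : ℝ} (ht : 0 < t)
    (h : ∀ᵐ x : EuclideanSpace ℝ (Fin N), u ((x, t) + w) - u (x, t) =
      ∫ r in Ioc (0 : ℝ) 1, inner ℝ (WithLp.toLp 2 w) (G ((x, t) + r • w))) :
    ∫⁻ x, ‖u ((x, t) + w) - u (x, t)‖ₑ ^ 2 ≤
      ENNReal.ofReal ((‖w.1‖ ^ 2 + w.2 ^ 2) * (w.2 ^ 2)⁻¹ * ((t + w.2) ^ (2 * s) / (2 * s))) *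
        ∫⁻ p, ‖G p‖ₑ ^ 2 ∂(weightedVolume N s) := by
  set g : ℝ → ℝ≥0∞ := fun τ => ∫⁻ x, ‖G (x, τ)‖ₑ ^ 2 with hg
  have hGm : Measurable fun p => ‖G p‖ₑ ^ 2 := hG.enorm.pow_const 2
  have hgm : Measurable g := hGm.lintegral_prod_left'
  have hW : ‖WithLp.toLp 2 w‖ₑ ^ 2 = ENNReal.ofReal (‖w.1‖ ^ 2 + w.2 ^ 2) := by
    rw [← ofReal_norm, ← ENNReal.ofReal_pow (norm_nonneg _), WithLp.prod_norm_sq_eq_of_L2]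
    simp
  have hpt : ∀ᵐ x : EuclideanSpace ℝ (Fin N), ‖u ((x, t) + w) - u (x, t)‖ₑ ^ 2 ≤
      ‖WithLp.toLp 2 w‖ₑ ^ 2 * ((ENNReal.ofReal w.2⁻¹ *
          ENNReal.ofReal ((t + w.2) ^ (2 * s) / (2 * s))) *
        ∫⁻ r in Ioc (0 : ℝ) 1, ENNReal.ofReal ((t + r * w.2) ^ (1 - 2 * s)) *
          ‖G ((x, t) + r • w)‖ₑ ^ 2) := by
    filter_upwards [h] with x hx
    have h1 : ‖u ((x, t) + w) - u (x, t)‖ₑ ≤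
        ‖WithLp.toLp 2 w‖ₑ * ∫⁻ r in Ioc (0 : ℝ) 1, ‖G ((x, t) + r • w)‖ₑ := by
      rw [hx, ← lintegral_const_mul' _ _ enorm_ne_top]
      refine (enorm_integral_le_lintegral_enorm _).trans (lintegral_mono fun r => ?_)
      simp only [← ofReal_norm]
      rw [← ENNReal.ofReal_mul (norm_nonneg _)]
      exact ENNReal.ofReal_le_ofReal (norm_inner_le_norm _ _)
    refine (pow_le_pow_left' h1 2).trans ?_
    rw [mul_pow]
    gcongr
    have hpos : ∀ᵐ r ∂(volume.restrict (Ioc (0 : ℝ) 1)), 0 < t + r * w.2 :=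
      (ae_restrict_mem measurableSet_Ioc).mono fun r hr => by have := hr.1; positivity
    refine (lintegral_sq_le_mul (m := fun r => (t + r * w.2) ^ (2 * s - 1)) (by fun_prop)
      (hpos.mono fun r hr => Real.rpow_pos_of_pos hr _)
      ((hG.comp_measurable (by fun_prop)).enorm.aemeasurable)).trans (mul_le_mul' ?_ ?_)
    · rw [lintegral_segment (fun τ => ENNReal.ofReal (τ ^ (2 * s - 1))) (by fun_prop) t hw]
      gcongr
      exact lintegral_rpow_le hs ht hw
    · refine (lintegral_congr_ae (hpos.mono fun r hr => ?_)).le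
      rw [← Real.rpow_neg hr.le, neg_sub]
      rfl
  refine (lintegral_mono_ae hpt).trans ?_
  have hm2 : Measurable fun z : EuclideanSpace ℝ (Fin N) × ℝ =>
      ENNReal.ofReal ((t + z.2 * w.2) ^ (1 - 2 * s)) * ‖G ((z.1, t) + z.2 • w)‖ₑ ^ 2 :=
    (by fun_prop : Measurable fun z : EuclideanSpace ℝ (Fin N) × ℝ =>
      ENNReal.ofReal ((t + z.2 * w.2) ^ (1 - 2 * s))).mul
      ((hG.comp_measurable (by fun_prop)).enorm.pow_const 2)
  have hB : ∫⁻ x : EuclideanSpace ℝ (Fin N), ∫⁻ r in Ioc (0 : ℝ) 1,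
      ENNReal.ofReal ((t + r * w.2) ^ (1 - 2 * s)) * ‖G ((x, t) + r • w)‖ₑ ^ 2 ≤
        ENNReal.ofReal w.2⁻¹ * ∫⁻ p, ‖G p‖ₑ ^ 2 ∂(weightedVolume N s) := by
    rw [lintegral_lintegral_swap hm2.aemeasurable, lintegral_weightedVolume s hGm]
    have h1 : ∀ r : ℝ, ∫⁻ x : EuclideanSpace ℝ (Fin N),
        ENNReal.ofReal ((t + r * w.2) ^ (1 - 2 * s)) * ‖G ((x, t) + r • w)‖ₑ ^ 2 =
        (fun τ => ENNReal.ofReal (τ ^ (1 - 2 * s)) * g τ) (t + r * w.2) := fun r => by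
      rw [lintegral_const_mul' _ _ ENNReal.ofReal_ne_top]
      simp only [hg]
      -- Integration over all `x` absorbs the horizontal shift `r • w.1`.
      rw [← lintegral_add_right_eq_self (fun x => ‖G (x, t + r * w.2)‖ₑ ^ 2) (r • w.1)]
      rfl
    rw [lintegral_congr h1, lintegral_segment (fun τ => ENNReal.ofReal (τ ^ (1 - 2 * s)) * g τ) (by fun_prop) t hw]
    gcongr
    exact fun τ hτ => ht.trans hτ.1
  have hC : ‖WithLp.toLp 2 w‖ₑ ^ 2 ≠ ⊤ := by simp
  rw [lintegral_const_mul' _ _ hC, lintegral_const_mul' _ _ (by finiteness)]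
  refine (mul_le_mul_right (mul_le_mul_right hB _) _).trans_eq ?_
  have e : (‖w.1‖ ^ 2 + w.2 ^ 2) * (w.2 ^ 2)⁻¹ * ((t + w.2) ^ (2 * s) / (2 * s)) =
      (‖w.1‖ ^ 2 + w.2 ^ 2) * ((w.2⁻¹ * ((t + w.2) ^ (2 * s) / (2 * s))) * w.2⁻¹) := by
    field_simp
  have p1 : 0 ≤ (t + w.2) ^ (2 * s) := Real.rpow_nonneg (by positivity) _
  rw [hW, e, ENNReal.ofReal_mul (by positivity), ENNReal.ofReal_mul (by positivity),
    ENNReal.ofReal_mul (by positivity)]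
  simp only [mul_assoc]

/-- Near the boundary, `u(·, t)` and the translates `u(· + z, τ)` are close in `L²`, for almost
every choice of the parameters. -/
theorem IsWeakGradient.ae_lintegral_slice_sub_le {s : ℝ} (hs : 0 < s)
    {u : EuclideanSpace ℝ (Fin N) × ℝ → ℝ}
    {G : EuclideanSpace ℝ (Fin N) × ℝ → GradVal N} (h : IsWeakGradient u G)
    (hu : StronglyMeasurable u) (hul : LocallyIntegrableOn u (halfSpace N)) :
    ∀ᵐ t ∂(volume.restrict (Ioi (0 : ℝ))), ∀ᵐ q : EuclideanSpace ℝ (Fin N) × ℝ, t < q.2 →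
      ∫⁻ x, ‖u (x + q.1, q.2) - u (x, t)‖ₑ ^ 2 ≤
        ENNReal.ofReal ((‖q.1‖ ^ 2 + (q.2 - t) ^ 2) * ((q.2 - t) ^ 2)⁻¹ *
          (q.2 ^ (2 * s) / (2 * s))) * ∫⁻ p, ‖G p‖ₑ ^ 2 ∂(weightedVolume N s) := by
  obtain ⟨G', hGs, hGG'⟩ : AEStronglyMeasurable G (halfVolume N) := h.1.aestronglyMeasurable
  have hG' := h.congr_right hGG'
  have hE : ∫⁻ p, ‖G p‖ₑ ^ 2 ∂(weightedVolume N s) =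
      ∫⁻ p, ‖G' p‖ₑ ^ 2 ∂(weightedVolume N s) := by
    refine lintegral_congr_ae ?_
    filter_upwards [(weightedVolume_ac s).ae_le hGG'] with p hp
    rw [hp]
  rw [hE]
  set I := ∫⁻ p, ‖G' p‖ₑ ^ 2 ∂(weightedVolume N s)
  let R : (EuclideanSpace ℝ (Fin N) × ℝ) × ℝ → Prop := fun z => 0 < z.1.2 →
    ∫⁻ x, ‖u ((x, z.2) + z.1) - u (x, z.2)‖ₑ ^ 2 ≤
      ENNReal.ofReal ((‖z.1.1‖ ^ 2 + z.1.2 ^ 2) * (z.1.2 ^ 2)⁻¹ *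
        ((z.2 + z.1.2) ^ (2 * s) / (2 * s))) * I
  -- The segment formula holds for each `w` at almost every `t`, whereas almost every `w` at a given
  -- `t` is wanted; measurability of `R` allows the exchange.
  have hRm : MeasurableSet {z | R z} := by
    refine MeasurableSet.imp (measurableSet_lt (by fun_prop) (by fun_prop))
      (measurableSet_le ?_ (by fun_prop))
    refine Measurable.lintegral_prod_right' (f := fun z :
      ((EuclideanSpace ℝ (Fin N) × ℝ) × ℝ) × EuclideanSpace ℝ (Fin N) =>
        ‖u ((z.2, z.1.2) + z.1.1) - u (z.2, z.1.2)‖ₑ ^ 2) ?_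
    exact ((hu.comp_measurable (by fun_prop)).sub
      (hu.comp_measurable (by fun_prop))).enorm.pow_const 2
  have hR : ∀ᵐ z ∂((volume : Measure (EuclideanSpace ℝ (Fin N) × ℝ)).prod
      (volume.restrict (Ioi (0 : ℝ)))), R z := by
    rw [Measure.ae_prod_iff_ae_ae hRm]
    refine Eventually.of_forall fun w => ?_
    by_cases hw : 0 < w.2
    · have h1 := hG'.ae_sub_eq_integral hu hul hGs hw.le
      rw [halfVolume_eq_prod] at h1
      filter_upwards [ae_ae_of_ae_prod_right h1, ae_restrict_mem measurableSet_Ioi] with t ht ht0 _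
      exact lintegral_slice_sub_le hs hGs hw ht0 ht
    · exact Eventually.of_forall fun t ht => absurd ht hw
  filter_upwards [ae_ae_of_ae_prod_right hR] with t ht
  -- The displacement `w` becomes the endpoint `q = w + (0, t)`.
  have h2 := (measurePreserving_sub_right volume
    ((0, t) : EuclideanSpace ℝ (Fin N) × ℝ)).quasiMeasurePreserving.ae ht
  filter_upwards [h2] with q hq htq
  have e : ∀ x, ((x, t) : EuclideanSpace ℝ (Fin N) × ℝ) + (q - (0, t)) = (x + q.1, q.2) :=
    fun x => Prod.ext (by simp) (by simp)
  simpa [R, htq, e] using hq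

end ExtensionSpace
end

/-! ### Averages of the truncated function -/

noncomputable section

namespace ExtensionSpace

variable {N : ℕ}

/-- The averaging weight `ρ(z) ε⁻¹ 1_{(ε, 2ε]}(τ)` on `ℝ^N × (0, ∞)`. -/
def avgWeight (ρ : EuclideanSpace ℝ (Fin N) → ℝ) (ε : ℝ) (q : EuclideanSpace ℝ (Fin N) × ℝ) : ℝ :=
  ρ q.1 * (Ioc ε (2 * ε)).indicator (fun _ => ε⁻¹) q.2

lemma exists_mollifier (N : ℕ) {ε : ℝ} (hε : 0 < ε) :
    ∃ ρ : EuclideanSpace ℝ (Fin N) → ℝ, Continuous ρ ∧ HasCompactSupport ρ ∧ (∀ x, 0 ≤ ρ x) ∧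
      (∀ x, ρ x ≠ 0 → ‖x‖ < ε) ∧ ∫⁻ x, ENNReal.ofReal (ρ x) = 1 := by
  let f : ContDiffBump (0 : EuclideanSpace ℝ (Fin N)) := ⟨ε / 2, ε, by positivity, by linarith⟩
  refine ⟨f.normed volume, f.continuous_normed, f.hasCompactSupport_normed, f.nonneg_normed,
    fun x hx => ?_, ?_⟩
  · have : x ∈ Function.support (f.normed volume) := hx
    rw [f.support_normed_eq] at this
    simpa using this
  · rw [← ofReal_integral_eq_lintegral_ofReal f.integrable_normed
      (Eventually.of_forall f.nonneg_normed), f.integral_normed, ENNReal.ofReal_one]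

section Average

variable {ρ : EuclideanSpace ℝ (Fin N) → ℝ} {ε : ℝ}

lemma stronglyMeasurable_avgWeight (hρ : Continuous ρ) : StronglyMeasurable (avgWeight ρ ε) := by
  refine (hρ.stronglyMeasurable.comp_measurable measurable_fst).mul ?_
  exact (stronglyMeasurable_const.indicator measurableSet_Ioc).comp_measurable measurable_snd

lemma avgWeight_nonneg (hε : 0 < ε) (hρ0 : ∀ x, 0 ≤ ρ x) (q : EuclideanSpace ℝ (Fin N) × ℝ) :
    0 ≤ avgWeight ρ ε q :=
  mul_nonneg (hρ0 _) (indicator_nonneg (fun _ _ => (inv_pos.2 hε).le) _)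

lemma lintegral_avgWeight_mul (hρ : Continuous ρ) (hρ0 : ∀ x, 0 ≤ ρ x)
    (hρ1 : ∫⁻ x, ENNReal.ofReal (ρ x) = 1) {g : ℝ → ℝ≥0∞} (hg : Measurable g) :
    ∫⁻ q, ENNReal.ofReal (avgWeight ρ ε q) * g q.2 =
      ENNReal.ofReal ε⁻¹ * ∫⁻ τ in Ioc ε (2 * ε), g τ := by
  have h1 : ∀ q : EuclideanSpace ℝ (Fin N) × ℝ, ENNReal.ofReal (avgWeight ρ ε q) * g q.2 =
      ENNReal.ofReal (ρ q.1) *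
        (Ioc ε (2 * ε)).indicator (fun τ => ENNReal.ofReal ε⁻¹ * g τ) q.2 := fun q => by
    rw [avgWeight, ENNReal.ofReal_mul (hρ0 _), mul_assoc]
    by_cases hq : q.2 ∈ Ioc ε (2 * ε) <;> simp [hq]
  rw [lintegral_congr h1, Measure.volume_eq_prod,
    lintegral_prod_mul (f := fun x => ENNReal.ofReal (ρ x))
      (g := (Ioc ε (2 * ε)).indicator fun τ => ENNReal.ofReal ε⁻¹ * g τ)
      (by fun_prop) ((by fun_prop : Measurable fun τ => ENNReal.ofReal ε⁻¹ * g τ).indicator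
        measurableSet_Ioc).aemeasurable, hρ1, one_mul, lintegral_indicator measurableSet_Ioc,
    lintegral_const_mul _ hg]

lemma lintegral_avgWeight (hε : 0 < ε) (hρ : Continuous ρ) (hρ0 : ∀ x, 0 ≤ ρ x)
    (hρ1 : ∫⁻ x, ENNReal.ofReal (ρ x) = 1) :
    ∫⁻ q, ENNReal.ofReal (avgWeight ρ ε q) = 1 := by
  have := lintegral_avgWeight_mul (ε := ε) hρ hρ0 hρ1 (g := 1) measurable_one
  simp only [Pi.one_apply, mul_one, setLIntegral_one, Real.volume_Ioc] at this
  rw [this, ← ENNReal.ofReal_mul (by positivity)]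
  field_simp
  norm_num

lemma add_sq_le_two_mul (a b : ℝ≥0∞) : (a + b) ^ 2 ≤ 2 * (a ^ 2 + b ^ 2) := by
  have := ENNReal.rpow_add_le_mul_rpow_add_rpow a b (p := 2) (by norm_num)
  norm_num at this
  exact_mod_cast this

/-- `L²` distance between a slice of `u` and an average of the truncation of `u` to `A`. -/
lemma lintegral_sub_average_le (hε : 0 < ε) (hρ : Continuous ρ) (hρ0 : ∀ x, 0 ≤ ρ x)
    (hρ1 : ∫⁻ x, ENNReal.ofReal (ρ x) = 1) {u : EuclideanSpace ℝ (Fin N) × ℝ → ℝ}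
    (hu : StronglyMeasurable u) {A : Set (EuclideanSpace ℝ (Fin N))} (hA : MeasurableSet A)
    {k : EuclideanSpace ℝ (Fin N) → ℝ} {t : ℝ} {B : ℝ≥0∞}
    (hint : ∀ x, Integrable fun q => avgWeight ρ ε q * (A ×ˢ univ).indicator u (q + (x, 0)))
    (hk : ∀ᵐ x, k x = ∫ q, avgWeight ρ ε q * (A ×ˢ univ).indicator u (q + (x, 0)))
    (hB : ∀ᵐ q : EuclideanSpace ℝ (Fin N) × ℝ, avgWeight ρ ε q ≠ 0 →
      ∫⁻ x, ‖u (x + q.1, q.2) - u (x, t)‖ₑ ^ 2 ≤ B) :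
    ∫⁻ x, ‖u (x, t) - k x‖ₑ ^ 2 ≤
      2 * (B + ENNReal.ofReal ε⁻¹ * ∫⁻ p in Aᶜ ×ˢ Ioc ε (2 * ε), ‖u p‖ₑ ^ 2) := by
  have hθm := stronglyMeasurable_avgWeight (ε := ε) hρ
  have hθ1 := lintegral_avgWeight hε hρ hρ0 hρ1
  have hθ0 := avgWeight_nonneg hε hρ0
  have hθi : Integrable (avgWeight ρ ε) := by
    refine ⟨hθm.aestronglyMeasurable, ?_⟩
    rw [HasFiniteIntegral]
    simp only [Real.enorm_of_nonneg (hθ0 _)]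
    rw [hθ1]
    exact ENNReal.one_lt_top
  have hθr : ∫ q, avgWeight ρ ε q = 1 := by
    rw [integral_eq_lintegral_of_nonneg_ae (Eventually.of_forall hθ0) hθm.aestronglyMeasurable, hθ1]
    rfl
  set θ : EuclideanSpace ℝ (Fin N) × ℝ → ℝ≥0∞ := fun q => ENNReal.ofReal (avgWeight ρ ε q) with hθ
  have hθmm : Measurable θ := hθm.measurable.ennreal_ofReal
  set c : EuclideanSpace ℝ (Fin N) × ℝ → ℝ := (Aᶜ ×ˢ univ).indicator u with hc
  have hcm : StronglyMeasurable c := hu.indicator (hA.compl.prod MeasurableSet.univ)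
  have hsplit : ∀ p, (A ×ˢ univ).indicator u p = u p - c p := fun p => by
    by_cases hp : p.1 ∈ A <;> simp [hc, indicator, hp]
  have hpt : ∀ᵐ x, ‖u (x, t) - k x‖ₑ ^ 2 ≤ ∫⁻ q, θ q * (2 *
      (‖u (x + q.1, q.2) - u (x, t)‖ₑ ^ 2 + ‖c (x + q.1, q.2)‖ₑ ^ 2)) := by
    filter_upwards [hk] with x hx
    have hm : Measurable fun q : EuclideanSpace ℝ (Fin N) × ℝ =>
        ‖u (x, t) - (A ×ˢ univ).indicator u (q + (x, 0))‖ₑ :=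
      (stronglyMeasurable_const.sub ((hu.indicator (hA.prod MeasurableSet.univ)).comp_measurable
        (by fun_prop))).enorm
    -- The weight has mass one, so `u (x, t)` may be moved under the average.
    have h1 : u (x, t) - k x = ∫ q, avgWeight ρ ε q *
        (u (x, t) - (A ×ˢ univ).indicator u (q + (x, 0))) := by
      simp only [mul_sub]
      rw [integral_sub (hθi.mul_const _) (hint x), integral_mul_const, hθr, hx, one_mul]
    have h2 : ‖u (x, t) - k x‖ₑ ≤ ∫⁻ q, ‖u (x, t) - (A ×ˢ univ).indicator u (q + (x, 0))‖ₑ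
        ∂(volume.withDensity θ) := by
      rw [lintegral_withDensity_eq_lintegral_mul _ hθmm hm, h1]
      refine (enorm_integral_le_lintegral_enorm _).trans_eq (lintegral_congr fun q => ?_)
      rw [enorm_mul, Real.enorm_of_nonneg (hθ0 _)]
      rfl
    have h3 : (volume.withDensity θ) univ = 1 := by
      rw [withDensity_apply _ MeasurableSet.univ, Measure.restrict_univ, hθ1]
    -- Jensen's inequality for the probability measure with density `θ`.
    refine (pow_le_pow_left' h2 2).trans ((lintegral_sq_le hm.aemeasurable).trans ?_)
    rw [h3, one_mul, lintegral_withDensity_eq_lintegral_mul _ hθmm (hm.pow_const 2)]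
    refine lintegral_mono fun q => ?_
    simp only [Pi.mul_apply]
    gcongr
    have e : q + (x, 0) = (x + q.1, q.2) := Prod.ext (add_comm _ _) (add_zero _)
    rw [hsplit, e, show u (x, t) - (u (x + q.1, q.2) - c (x + q.1, q.2)) =
      c (x + q.1, q.2) - (u (x + q.1, q.2) - u (x, t)) by ring, add_comm (_ ^ 2)]
    exact (pow_le_pow_left' enorm_sub_le 2).trans (add_sq_le_two_mul _ _)
  refine (lintegral_mono_ae hpt).trans ?_
  have m1 : Measurable fun z : EuclideanSpace ℝ (Fin N) × (EuclideanSpace ℝ (Fin N) × ℝ) =>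
      ‖u (z.1 + z.2.1, z.2.2) - u (z.1, t)‖ₑ ^ 2 :=
    ((hu.comp_measurable (by fun_prop)).sub (hu.comp_measurable (by fun_prop))).enorm.pow_const 2
  have m2 : Measurable fun z : EuclideanSpace ℝ (Fin N) × (EuclideanSpace ℝ (Fin N) × ℝ) =>
      ‖c (z.1 + z.2.1, z.2.2)‖ₑ ^ 2 := (hcm.comp_measurable (by fun_prop)).enorm.pow_const 2
  have m3 : Measurable fun p => ‖c p‖ₑ ^ 2 := hcm.enorm.pow_const 2
  have m4 : Measurable fun τ => ∫⁻ x, ‖c (x, τ)‖ₑ ^ 2 := m3.lintegral_prod_left'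
  rw [lintegral_lintegral_swap (((hθmm.comp measurable_snd).mul
    ((m1.add m2).const_mul 2)).aemeasurable)]
  have hq : ∀ q, ∫⁻ x, θ q * (2 *
      (‖u (x + q.1, q.2) - u (x, t)‖ₑ ^ 2 + ‖c (x + q.1, q.2)‖ₑ ^ 2)) =
      2 * (θ q * (∫⁻ x, ‖u (x + q.1, q.2) - u (x, t)‖ₑ ^ 2) +
        θ q * ∫⁻ x, ‖c (x, q.2)‖ₑ ^ 2) := fun q => by
    have m5 : Measurable fun x => ‖u (x + q.1, q.2) - u (x, t)‖ₑ ^ 2 :=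
      ((hu.comp_measurable (by fun_prop)).sub (hu.comp_measurable (by fun_prop))).enorm.pow_const 2
    rw [lintegral_const_mul' _ _ ENNReal.ofReal_ne_top, lintegral_const_mul' _ _ (by simp),
      lintegral_add_left m5,
      lintegral_add_right_eq_self (fun x => ‖c (x, q.2)‖ₑ ^ 2) q.1]
    ring
  have m6 : Measurable fun q : EuclideanSpace ℝ (Fin N) × ℝ => θ q * ∫⁻ x, ‖c (x, q.2)‖ₑ ^ 2 :=
    hθmm.mul (m4.comp measurable_snd)
  rw [lintegral_congr hq, lintegral_const_mul' _ _ (by simp), lintegral_add_right _ m6,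
    lintegral_avgWeight_mul hρ hρ0 hρ1 m4]
  refine mul_le_mul_right (add_le_add ?_ (le_of_eq ?_)) _
  · calc _ ≤ ∫⁻ q, θ q * B := by
          refine lintegral_mono_ae (hB.mono fun q hq => ?_)
          by_cases h0 : avgWeight ρ ε q = 0
          · simp [hθ, h0]
          · gcongr
            exact hq h0
      _ = B := by rw [lintegral_mul_const _ hθmm, hθ1, one_mul]
  · congr 1
    rw [← lintegral_prod_symm' (μ := volume) (ν := volume.restrict (Ioc ε (2 * ε))) _ m3]
    have h1 : ∀ p, ‖c p‖ₑ ^ 2 = (Aᶜ ×ˢ univ).indicator (fun p => ‖u p‖ₑ ^ 2) p := fun p => by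
      by_cases hp : p.1 ∈ A <;> simp [hc, indicator, hp]
    rw [lintegral_congr h1, lintegral_indicator (hA.compl.prod MeasurableSet.univ),
      ← Measure.restrict_univ (μ := (volume : Measure (EuclideanSpace ℝ (Fin N)))),
      Measure.prod_restrict, Measure.restrict_restrict (hA.compl.prod MeasurableSet.univ),
      prod_inter_prod, inter_univ, univ_inter, ← Measure.volume_eq_prod]

end Average

end ExtensionSpace
end

/-! ### The averaging kernel as a square integrable map into `L²(S)` -/

noncomputable section

namespace ExtensionSpace

lemma eLpNorm_two_sq {α F : Type*} [MeasurableSpace α] [NormedAddCommGroup F] (μ : Measure α)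
    (f : α → F) : eLpNorm f 2 μ ^ 2 = ∫⁻ a, ‖f a‖ₑ ^ 2 ∂μ := by
  have := eLpNorm_nnreal_pow_eq_lintegral (f := f) (μ := μ) (p := 2) two_ne_zero
  simp only [NNReal.coe_ofNat, ENNReal.rpow_two] at this
  exact this

variable {N : ℕ}

section Kernel

variable {S : Set (EuclideanSpace ℝ (Fin N) × ℝ)} {ρ : EuclideanSpace ℝ (Fin N) → ℝ}

lemma memLp_translate (hS : volume S < ⊤) (hρ : Continuous ρ) (hρc : HasCompactSupport ρ) (c : ℝ)
    (x : EuclideanSpace ℝ (Fin N)) :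
    MemLp (fun p : EuclideanSpace ℝ (Fin N) × ℝ => c * ρ (p.1 - x)) 2 (volume.restrict S) := by
  have : IsFiniteMeasure (volume.restrict S) := ⟨by simpa using hS⟩
  obtain ⟨C, hC⟩ := hρ.bounded_above_of_compact_support hρc
  refine MemLp.of_bound (by fun_prop) (‖c‖ * C) (Eventually.of_forall fun p => ?_)
  rw [norm_mul]
  gcongr
  exact hC _

/-- Uniform continuity of `ρ` and finite measure of `S` give continuity, which is used for strong
measurability of the kernel. -/
lemma continuous_translate (hS : volume S < ⊤) (hρ : Continuous ρ) (hρc : HasCompactSupport ρ)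
    (c : ℝ) : Continuous fun x => (memLp_translate hS hρ hρc c x).toLp _ := by
  have : IsFiniteMeasure (volume.restrict S) := ⟨by simpa using hS⟩
  have hu : UniformContinuous ρ := hρc.uniformContinuous_of_continuous hρ
  rw [Metric.continuous_iff]
  intro x η hη
  -- The summand `1` makes `D` positive and the final inequality strict.
  set D : ℝ := measureUnivNNReal (volume.restrict S) ^ ((2 : ℝ≥0∞).toReal⁻¹) * ‖c‖ + 1 with hD
  have hD0 : 0 < D := by positivity
  obtain ⟨δ, hδ, h⟩ := Metric.uniformContinuous_iff.1 hu (η / D) (by positivity)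
  refine ⟨δ, hδ, fun y hy => ?_⟩
  rw [dist_eq_norm, ← MemLp.toLp_sub]
  have hb : ∀ᵐ p ∂(volume.restrict S), ‖((memLp_translate hS hρ hρc c y).sub
      (memLp_translate hS hρ hρc c x)).toLp _ p‖ ≤ ‖c‖ * (η / D) := by
    filter_upwards [((memLp_translate hS hρ hρc c y).sub
      (memLp_translate hS hρ hρc c x)).coeFn_toLp] with p hp
    rw [hp, Pi.sub_apply, ← mul_sub, norm_mul]
    gcongr
    rw [← dist_eq_norm]
    refine (h ?_).le
    rw [dist_sub_left]
    exact hy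
  refine (Lp.norm_le_of_ae_bound (by positivity) hb).trans_lt ?_
  calc _ = (D - 1) * (η / D) := by rw [hD]; ring
    _ < D * (η / D) := by gcongr; linarith
    _ = η := by field_simp

lemma memLp_translate_kernel (hS : volume S < ⊤) (hρ : Continuous ρ)
    (hρc : HasCompactSupport ρ) (c : ℝ) :
    MemLp (fun x => (memLp_translate hS hρ hρc c x).toLp _) 2 volume := by
  have : IsFiniteMeasure (volume.restrict S) := ⟨by simpa using hS⟩
  refine ⟨(continuous_translate hS hρ hρc c).aestronglyMeasurable, ?_⟩
  have h1 : eLpNorm (fun x => (memLp_translate hS hρ hρc c x).toLp _) 2 volume ^ 2 < ⊤ := by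
    rw [eLpNorm_two_sq]
    simp only [Lp.enorm_toLp, eLpNorm_two_sq]
    have hm : Measurable fun z : EuclideanSpace ℝ (Fin N) × (EuclideanSpace ℝ (Fin N) × ℝ) =>
        ‖c * ρ (z.2.1 - z.1)‖ₑ ^ 2 :=
      (by fun_prop : Continuous fun z : EuclideanSpace ℝ (Fin N) × (EuclideanSpace ℝ (Fin N) × ℝ) =>
        c * ρ (z.2.1 - z.1)).measurable.enorm.pow_const 2
    -- Integrating in `x` first removes the dependence on `p`, leaving the squared norm of `c * ρ`
    -- times the volume of `S`.
    rw [lintegral_lintegral_swap hm.aemeasurable]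
    have h2 : ∀ p : EuclideanSpace ℝ (Fin N) × ℝ,
        ∫⁻ x, ‖c * ρ (p.1 - x)‖ₑ ^ 2 = ∫⁻ x, ‖c * ρ x‖ₑ ^ 2 := fun p =>
      lintegral_sub_left_eq_self (fun x => ‖c * ρ x‖ₑ ^ 2) p.1
    rw [lintegral_congr h2, lintegral_const, Measure.restrict_apply_univ, ← eLpNorm_two_sq]
    refine ENNReal.mul_lt_top (ENNReal.pow_lt_top ?_) hS
    exact ((hρ.memLp_of_hasCompactSupport hρc).const_mul c).2
  exact (ENNReal.pow_lt_top_iff.1 h1).resolve_right two_ne_zero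

end Kernel

/-! ### Compact approximation of slices -/

variable {b : EuclideanSpace ℝ (Fin N) → ℝ} {s : ℝ}

/-- The inclusion of the extension space into `L²(b t^{1-2s} dx dt)`. -/
def H.toPotential (b : EuclideanSpace ℝ (Fin N) → ℝ) (s : ℝ) :
    H b s →L[ℝ] Lp ℝ 2 (potentialVolume b s) :=
  LinearMap.mkContinuous
    { toFun := fun u => (H.energyMap b s u).fst
      map_add' := fun u v => by rw [map_add]; rfl
      map_smul' := fun c u => by rw [map_smul]; rfl } 1
    fun u => (WithLp.norm_fst_le _ (H.energyMap b s u)).trans_eq (one_mul _).symm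

lemma H.coeFn_toPotential (u : H b s) : H.toPotential b s u =ᵐ[potentialVolume b s] u.toFun :=
  u.memLp_toFun.coeFn_toLp

lemma H.lintegral_toFun_le (u : H b s) :
    ∫⁻ p, ‖u.toFun p‖ₑ ^ 2 ∂(potentialVolume b s) ≤ ‖u‖ₑ ^ 2 := by
  rw [← eLpNorm_two_sq, ← Lp.enorm_toLp (hf := u.memLp_toFun), ← ofReal_norm, ← ofReal_norm]
  exact pow_le_pow_left' (ENNReal.ofReal_le_ofReal
    (WithLp.norm_fst_le _ (H.energyMap b s u))) 2

lemma H.lintegral_grad_le (u : H b s) :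
    ∫⁻ p, ‖u.grad p‖ₑ ^ 2 ∂(weightedVolume N s) ≤ ‖u‖ₑ ^ 2 := by
  rw [← eLpNorm_two_sq, ← Lp.enorm_toLp (hf := u.memLp_grad), ← ofReal_norm, ← ofReal_norm]
  exact pow_le_pow_left' (ENNReal.ofReal_le_ofReal
    (WithLp.norm_snd_le _ (H.energyMap b s u))) 2

/-- Away from `t = 0` the weight is bounded below whatever the sign of `1 - 2s`; compactness avoids
a case distinction. -/
lemma exists_one_le_mul_rpow (s : ℝ) {ε : ℝ} (hε : 0 < ε) :
    ∃ L : ℝ, 0 < L ∧ ∀ τ ∈ Ioc ε (2 * ε), 1 ≤ L * τ ^ (1 - 2 * s) := by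
  obtain ⟨C, hC⟩ := (isCompact_Icc (a := ε) (b := 2 * ε)).exists_bound_of_continuousOn
    (f := fun τ : ℝ => τ ^ (2 * s - 1))
    (fun τ hτ => (Real.continuousAt_rpow_const τ _
      (Or.inl (hε.trans_le hτ.1).ne')).continuousWithinAt)
  refine ⟨|C| + 1, by positivity, fun τ hτ => ?_⟩
  have hτ0 : 0 < τ := hε.trans hτ.1
  have h1 : τ ^ (2 * s - 1) ≤ |C| + 1 := by
    have := hC τ (Ioc_subset_Icc_self hτ)
    linarith [le_abs_self C, le_abs_self (τ ^ (2 * s - 1)), Real.norm_eq_abs (τ ^ (2 * s - 1))]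
  calc (1 : ℝ) = τ ^ (2 * s - 1) * τ ^ (1 - 2 * s) := by
        rw [← Real.rpow_add hτ0]; norm_num
    _ ≤ _ := by gcongr

/-- Serves twice: on `{b ≤ M}`, with the global lower bound of `b`, to restrict `u` continuously to
`L²(S)`; on the complement, with lower bound `M`, to make the tail small. -/
lemma restrict_le_smul_potentialVolume (hb : Continuous b) {B : Set (EuclideanSpace ℝ (Fin N))}
    (hB : MeasurableSet B) {m : ℝ} (hm : 0 < m) (hmB : ∀ x ∈ B, m ≤ b x) {ε L : ℝ} (hε : 0 < ε)
    (hL : 0 < L) (h : ∀ τ ∈ Ioc ε (2 * ε), 1 ≤ L * τ ^ (1 - 2 * s)) :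
    volume.restrict (B ×ˢ Ioc ε (2 * ε)) ≤ ENNReal.ofReal (L / m) • potentialVolume b s := by
  have hS : MeasurableSet (B ×ˢ Ioc ε (2 * ε)) := hB.prod measurableSet_Ioc
  have hsub : B ×ˢ Ioc ε (2 * ε) ⊆ halfSpace N := fun p hp => ⟨mem_univ _, hε.trans hp.2.1⟩
  have hbm : Measurable fun p : EuclideanSpace ℝ (Fin N) × ℝ => ENNReal.ofReal (b p.1) :=
    (hb.measurable.comp measurable_fst).ennreal_ofReal
  have hwm : Measurable fun p : EuclideanSpace ℝ (Fin N) × ℝ =>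
    ENNReal.ofReal (p.2 ^ (1 - 2 * s)) := by fun_prop
  rw [potentialVolume, weightedVolume, ← withDensity_mul _ hwm hbm,
    ← withDensity_smul _ (hwm.mul hbm), ← inter_eq_left.2 hsub,
    ← Measure.restrict_restrict hS, ← withDensity_indicator_one hS]
  refine withDensity_mono (Eventually.of_forall fun p => ?_)
  by_cases hp : p ∈ B ×ˢ Ioc ε (2 * ε)
  · have hp0 : 0 < p.2 := hε.trans hp.2.1
    have hr := Real.rpow_pos_of_pos hp0 (1 - 2 * s)
    rw [indicator_of_mem hp]
    simp only [Pi.smul_apply, Pi.mul_apply, smul_eq_mul, Pi.one_apply]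
    rw [← ENNReal.ofReal_mul (by positivity), ← ENNReal.ofReal_mul (by positivity),
      ENNReal.one_le_ofReal]
    calc (1 : ℝ) ≤ L * p.2 ^ (1 - 2 * s) := h _ hp.2
      _ = L / m * (p.2 ^ (1 - 2 * s) * m) := by field_simp
      _ ≤ _ := by gcongr; exact hmB _ hp.1
  · rw [indicator_of_notMem hp]
    exact zero_le

/-- Uniform error of the approximation of slices at height `t < ε / 2` by averages at scale `ε`. -/
def approxRate (s ε : ℝ) : ℝ := √(2 * (5 * ((2 * ε) ^ (2 * s) / (2 * s)) + ε))

lemma tendsto_approxRate (hs : 0 < s) :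
    Tendsto (fun n : ℕ => approxRate s (1 / ((n : ℝ) + 1))) atTop (𝓝 0) := by
  have h1 : Tendsto (fun n : ℕ => (1 : ℝ) / ((n : ℝ) + 1)) atTop (𝓝 0) :=
    tendsto_one_div_add_atTop_nhds_zero_nat
  have h2 : ContinuousAt (approxRate s) 0 := by
    unfold approxRate
    refine Real.continuous_sqrt.continuousAt.comp (continuousAt_const.mul
      ((continuousAt_const.mul (ContinuousAt.div_const ?_ _)).add continuousAt_id))
    exact (Real.continuousAt_rpow_const _ _ (Or.inr (by linarith))).comp
      (continuousAt_const.mul continuousAt_id)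
  have h3 : approxRate s 0 = 0 := by
    simp [approxRate, Real.zero_rpow (by linarith : 2 * s ≠ 0)]
  have := h2.tendsto.comp h1
  rwa [h3] at this

/-- For almost every `t < ε / 2`, the slice `u(·, t)` is approximated by a compact operator. -/
theorem exists_compact_approx (hs : 0 < s) (hb : Continuous b) {m : ℝ} (hm : 0 < m)
    (hmb : ∀ x, m ≤ b x) (hfin : ∀ M : ℝ, 0 < M → volume {x | b x ≤ M} < ⊤) {ε : ℝ} (hε : 0 < ε) :
    ∃ K : H b s →L[ℝ] Lp ℝ 2 (volume : Measure (EuclideanSpace ℝ (Fin N))),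
      IsCompactOperator K ∧ ∀ u : H b s, ∀ᵐ t ∂(volume.restrict (Ioi (0 : ℝ))), t < ε / 2 →
        eLpNorm (fun x => u.toFun (x, t) - K u x) 2 volume ≤
          ENNReal.ofReal (approxRate s ε * ‖u‖) := by
  obtain ⟨L, hL, hLε⟩ := exists_one_le_mul_rpow s hε
  obtain ⟨ρ, hρ, hρc, hρ0, hρε, hρ1⟩ := exists_mollifier N hε
  -- Chosen so that the tail constant `ε⁻¹ * (L / M)` equals `ε`.
  set M : ℝ := L / ε ^ 2 with hM
  have hM0 : 0 < M := by positivity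
  set A : Set (EuclideanSpace ℝ (Fin N)) := {x | b x ≤ M} with hA
  have hAm : MeasurableSet A := measurableSet_le hb.measurable measurable_const
  set S : Set (EuclideanSpace ℝ (Fin N) × ℝ) := A ×ˢ Ioc ε (2 * ε) with hS
  have hSm : MeasurableSet S := hAm.prod measurableSet_Ioc
  have hSv : volume S < ⊤ := by
    rw [hS, Measure.volume_eq_prod, Measure.prod_prod]
    exact ENNReal.mul_lt_top (hfin M hM0) (by simp)
  have hle := restrict_le_smul_potentialVolume (s := s) hb hAm hm (fun x _ => hmb x) hε hL hLε
  have hac : volume.restrict S ≪ potentialVolume b s := Measure.absolutelyContinuous_of_le_smul hle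
  set k := (memLp_translate_kernel hSv hρ hρc ε⁻¹).toLp _ with hk
  set ι : Lp ℝ 2 (potentialVolume b s) →L[ℝ] Lp ℝ 2 (volume.restrict S) :=
    Lp.LpToLpOfMeasureLeSMul ENNReal.ofReal_ne_top hle
  refine ⟨(kernelOperator k).comp (ι.comp (H.toPotential b s)),
    (isCompactOperator_kernelOperator k).comp_clm _, fun u => ?_⟩
  have hιu : ι (H.toPotential b s u) =ᵐ[volume.restrict S] u.toFun :=
    (Lp.coeFn_LpToLpOfMeasureLeSMul _ _ _).trans (hac.ae_le (H.coeFn_toPotential u))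
  -- After the substitution `p = q + (x, 0)`, the average becomes the `L²(S)` pairing of `u` with
  -- the kernel at `x`.
  have heq : ∀ x p, avgWeight ρ ε (p - (x, 0)) * (A ×ˢ univ).indicator u.toFun p =
      S.indicator (fun p => u.toFun p * (ε⁻¹ * ρ (p.1 - x))) p := fun x p => by
    by_cases h1 : p.1 ∈ A <;> by_cases h2 : p.2 ∈ Ioc ε (2 * ε) <;>
      simp [avgWeight, indicator, hS, h1, h2]
    ring
  have hint : ∀ x, Integrable fun q =>
      avgWeight ρ ε q * (A ×ˢ univ).indicator u.toFun (q + (x, 0)) := fun x => by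
    have h1 : Integrable fun p =>
        avgWeight ρ ε (p - (x, 0)) * (A ×ˢ univ).indicator u.toFun p := by
      simp only [heq]
      rw [integrable_indicator_iff hSm]
      exact (u.memLp_toFun.of_measure_le_smul ENNReal.ofReal_ne_top hle).integrable_mul
        (memLp_translate hSv hρ hρc ε⁻¹ x)
    simpa using h1.comp_add_right (x, 0)
  have hK : ∀ᵐ x, ((kernelOperator k).comp (ι.comp (H.toPotential b s))) u x =
      ∫ q, avgWeight ρ ε q * (A ×ˢ univ).indicator u.toFun (q + (x, 0)) := by
    filter_upwards [coeFn_kernelOperator k (ι (H.toPotential b s u)),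
      (memLp_translate_kernel hSv hρ hρc ε⁻¹).coeFn_toLp] with x h1 h2
    simp only [ContinuousLinearMap.comp_apply]
    rw [h1, hk, h2, L2.inner_def,
      ← integral_sub_right_eq_self (fun q => avgWeight ρ ε q *
        (A ×ˢ univ).indicator u.toFun (q + (x, 0))) ((x, 0) : EuclideanSpace ℝ (Fin N) × ℝ)]
    simp only [sub_add_cancel, heq]
    rw [integral_indicator hSm]
    refine integral_congr_ae ?_
    filter_upwards [hιu, (memLp_translate hSv hρ hρc ε⁻¹ x).coeFn_toLp] with p h3 h4
    rw [h3, h4]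
    simp [mul_comm]
  have hul : LocallyIntegrableOn u.toFun (halfSpace N) :=
    locallyIntegrableOn_halfSpace_of_memLp (Lp.memLp (Subtype.val u))
  filter_upwards [u.isWeakGradient_grad.ae_lintegral_slice_sub_le hs
    u.stronglyMeasurable_toFun hul] with t ht htε
  have hB : ∀ᵐ q : EuclideanSpace ℝ (Fin N) × ℝ, avgWeight ρ ε q ≠ 0 →
      ∫⁻ x, ‖u.toFun (x + q.1, q.2) - u.toFun (x, t)‖ₑ ^ 2 ≤
        ENNReal.ofReal (5 * ((2 * ε) ^ (2 * s) / (2 * s))) * ‖u‖ₑ ^ 2 := by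
    filter_upwards [ht] with q hq hne
    have hq1 : ‖q.1‖ < ε := hρε _ (left_ne_zero_of_mul hne)
    have hq2 : q.2 ∈ Ioc ε (2 * ε) := by
      by_contra hn
      exact right_ne_zero_of_mul hne (indicator_of_notMem hn _)
    have hd : ε / 2 < q.2 - t := by linarith [hq2.1]
    have hd0 : 0 < q.2 - t := by linarith
    have hq0 : 0 < q.2 := hε.trans hq2.1
    refine (hq (by linarith)).trans (mul_le_mul' (ENNReal.ofReal_le_ofReal ?_)
      u.lintegral_grad_le)
    -- From `‖q.1‖ < ε < 2 (q.2 - t)`: the horizontal part contributes at most `4`, the vertical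
    -- part `1`.
    have h5 : (‖q.1‖ ^ 2 + (q.2 - t) ^ 2) * ((q.2 - t) ^ 2)⁻¹ ≤ 5 := by
      rw [← div_eq_mul_inv, div_le_iff₀ (by positivity)]
      nlinarith [norm_nonneg q.1]
    gcongr
    exact hq2.2
  have hE := lintegral_sub_average_le hε hρ hρ0 hρ1 u.stronglyMeasurable_toFun hAm hint hK hB
  have hle' := restrict_le_smul_potentialVolume (s := s) hb hAm.compl hM0
    (fun x (hx : ¬ b x ≤ M) => (not_le.1 hx).le) hε hL hLε
  have hE2 : ∫⁻ p in Aᶜ ×ˢ Ioc ε (2 * ε), ‖u.toFun p‖ₑ ^ 2 ≤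
      ENNReal.ofReal (L / M) * ‖u‖ₑ ^ 2 := by
    refine (lintegral_mono' hle' le_rfl).trans ?_
    rw [lintegral_smul_measure, smul_eq_mul]
    gcongr
    exact u.lintegral_toFun_le
  have hr : 0 ≤ 5 * ((2 * ε) ^ (2 * s) / (2 * s)) := by positivity
  rw [← ENNReal.pow_le_pow_left_iff two_ne_zero, eLpNorm_two_sq,
    approxRate, ENNReal.ofReal_mul (Real.sqrt_nonneg _), ofReal_norm, mul_pow,
    ← ENNReal.ofReal_pow (Real.sqrt_nonneg _), Real.sq_sqrt (by positivity)]
  refine hE.trans ((mul_le_mul_right (add_le_add_right (mul_le_mul_right hE2 _) _) _).trans_eq ?_)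
  have hLM : ε⁻¹ * (L / M) = ε := by rw [hM]; field_simp
  rw [← mul_assoc (ENNReal.ofReal ε⁻¹), ← ENNReal.ofReal_mul (by positivity), hLM, ← add_mul,
    ← ENNReal.ofReal_add hr hε.le, ← mul_assoc, ENNReal.ofReal_mul two_pos.le]
  norm_num

end ExtensionSpace
end

theorem mainTheorem8 (N : ℕ) (hN : 1 ≤ N) (s : ℝ) (hs : s ∈ Set.Ioo (0 : ℝ) 1)
    (b : EuclideanSpace ℝ (Fin N) → ℝ) (hb : Continuous b) (hinf : 0 < ⨅ x, b x)
    (hfin : ∀ M : ℝ, 0 < M → volume {x | b x ≤ M} < ⊤) :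
    ∃ T : ExtensionSpace.H b s →L[ℝ] Lp ℝ 2 (volume : Measure (EuclideanSpace ℝ (Fin N))),
      (∀ (u : ExtensionSpace.H b s)
          (g : Lp ℝ 2 (volume : Measure (EuclideanSpace ℝ (Fin N)))),
        ExtensionSpace.IsTrace u.toFun g ↔ T u = g) ∧
      IsCompactOperator T := by
  -- The real infimum of a set unbounded below is `0` by convention, so positivity of the infimum
  -- forces a genuine lower bound.
  have hbdd : BddBelow (Set.range b) := by
    by_contra h
    rw [iInf, Real.sInf_of_not_bddBelow h] at hinf
    exact lt_irrefl _ hinf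
  have hε : ∀ n : ℕ, (0 : ℝ) < 1 / ((n : ℝ) + 1) := fun n => by positivity
  choose K hK h using fun n : ℕ => ExtensionSpace.exists_compact_approx hs.1 hb hinf
    (fun x => ciInf_le hbdd x) hfin (hε n)
  refine ExtensionSpace.exists_trace_of_approx K hK _ (fun n => Real.sqrt_nonneg _)
    (ExtensionSpace.tendsto_approxRate hs.1) fun n u => ?_
  have h1 := h n u
  rw [ae_restrict_iff' measurableSet_Ioi] at h1
  -- The conull set comes from the `ae` factor of the filter, the range `0 < t < ε / 2` from the
  -- neighbourhood factor.
  filter_upwards [mem_inf_of_right h1,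
    mem_inf_of_left (Ioo_mem_nhdsGT (half_pos (hε n)))] with t ht1 ht2
  exact ht1 ht2.1 ht2.2
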